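/- Let $a,b,s\in\mathbb{R}$ satisfy $$\frac12-\frac1b=s,\qquad 3\Big(\frac1a-\frac12\Big)=\frac2s-4,\qquad 2<b<\infty,\qquad 1\le a<2.$$ Then there is a constant $C>0$, depending only on $a$, $b$, $s$, such that every $f\in H^2(\mathbb{R}^3)$ (complex-valued) satisfies $$\|f\|_{L^b(\mathbb{R}^3)}\le C\,\|\partial_3 f\|_{L^a(\mathbb{R}^3)}^{\,s}\;\|\nabla^2 f\|_{L^2(\mathbb{R}^3)}^{\,1-s},$$ where $\partial_3 f$ and $\nabla^2 f=(\partial_i\partial_j f)_{1\le i,j\le 3}$ are distributional derivatives (which are square integrable functions), and $\|\partial_3 f\|_{L^a}$ may be $+\infty$ (with the convention $\infty\cdot 0=0$ on the right-hand side). -/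

import Mathlib

open MeasureTheory TemperedDistribution
open scoped SchwartzMap LineDeriv ENNReal NNReal

noncomputable section

/-- The space `ℝ³` with its Euclidean structure; the coordinates `x₁, x₂, x₃` have indices
`0, 1, 2`. -/
abbrev R3 : Type := EuclideanSpace ℝ (Fin 3)

/-- The standard basis vectors of `ℝ³`. -/
def stdBasis (i : Fin 3) : R3 := EuclideanSpace.single i 1

/-- Membership of `f ∈ L²(ℝ³; ℂ)` in the Sobolev space `H²(ℝ³)`. -/
def MemH2 (f : Lp ℂ 2 (volume : Measure R3)) : Prop :=
  MemSobolev 2 2 (f : 𝓢'(R3, ℂ))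

open Classical in
/-- The square integrable function that represents the tempered distribution `u`, if there is one
(it is then unique, see `l2Repr_unique`), and `0` otherwise. -/
def l2Repr (u : 𝓢'(R3, ℂ)) : Lp ℂ 2 (volume : Measure R3) :=
  if h : ∃ g : Lp ℂ 2 (volume : Measure R3), u = (g : 𝓢'(R3, ℂ)) then h.choose else 0

/-- The distributional derivative `∂ᵢ f`, as a square integrable function. -/
def partialDeriv (i : Fin 3) (f : Lp ℂ 2 (volume : Measure R3)) :
    Lp ℂ 2 (volume : Measure R3) :=
  l2Repr (∂_{stdBasis i} (f : 𝓢'(R3, ℂ)))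

/-- The distributional derivative `∂ᵢ ∂ⱼ f`, as a square integrable function. -/
def partialDeriv₂ (i j : Fin 3) (f : Lp ℂ 2 (volume : Measure R3)) :
    Lp ℂ 2 (volume : Measure R3) :=
  l2Repr (∂_{stdBasis i} (∂_{stdBasis j} (f : 𝓢'(R3, ℂ))))

/-- The Hessian `∇² f = (∂ᵢ ∂ⱼ f)ᵢⱼ`, pointwise with the Euclidean (Frobenius) norm. -/
def hessian (f : Lp ℂ 2 (volume : Measure R3)) (x : R3) : EuclideanSpace ℂ (Fin 3 × Fin 3) :=
  WithLp.toLp 2 fun ij => partialDeriv₂ ij.1 ij.2 f x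

theorem l2Repr_unique (g : Lp ℂ 2 (volume : Measure R3)) : l2Repr (g : 𝓢'(R3, ℂ)) = g := by
  have h : ∃ g' : Lp ℂ 2 (volume : Measure R3), (g : 𝓢'(R3, ℂ)) = (g' : 𝓢'(R3, ℂ)) := ⟨g, rfl⟩
  have hc := h.choose_spec
  rw [l2Repr, dif_pos h]
  have hk := LinearMap.ker_eq_bot.mp
    (Lp.ker_toTemperedDistributionCLM_eq_bot (F := ℂ) (μ := (volume : Measure R3)) (p := 2))
  exact hk hc.symm

theorem coe_partialDeriv {f : Lp ℂ 2 (volume : Measure R3)} (hf : MemH2 f) (i : Fin 3) :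
    (partialDeriv i f : 𝓢'(R3, ℂ)) = ∂_{stdBasis i} (f : 𝓢'(R3, ℂ)) := by
  have h : MemSobolev 0 2 (∂_{stdBasis i} (f : 𝓢'(R3, ℂ))) := by
    refine MemSobolev.mono (s := 1) (by norm_num) ?_
    have := MemSobolev.lineDerivOp (m := stdBasis i) hf
    norm_num at this
    exact this
  obtain ⟨g, hg⟩ := memSobolev_zero_iff.mp h
  rw [partialDeriv, hg, l2Repr_unique]

theorem coe_partialDeriv₂ {f : Lp ℂ 2 (volume : Measure R3)} (hf : MemH2 f) (i j : Fin 3) :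
    (partialDeriv₂ i j f : 𝓢'(R3, ℂ)) =
      ∂_{stdBasis i} (∂_{stdBasis j} (f : 𝓢'(R3, ℂ))) := by
  have h : MemSobolev 0 2 (∂_{stdBasis i} (∂_{stdBasis j} (f : 𝓢'(R3, ℂ)))) := by
    have := MemSobolev.lineDerivOp (m := stdBasis i) (MemSobolev.lineDerivOp (m := stdBasis j) hf)
    norm_num at this
    exact this
  obtain ⟨g, hg⟩ := memSobolev_zero_iff.mp h
  rw [partialDeriv₂, hg, l2Repr_unique]

end

/-! Put `1/a = 1/2 + 2/β` and `k = b/2`. The exponent relations then say `k = 1 + 2β/3` and `s =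
(k-1)/(2k)`, and `a ≥ 1` says `β ≥ 4`. Write `A = ‖∂₃u‖_a` and `H` for the L² size of the Hessian.
For compactly supported C² functions the estimate is the composition of two inequalities passing
through `L^β`.

The first is `‖u‖_β ≤ C (A H)^{1/2}` (`exists_eLpNorm_le_coordDeriv_mul_hessianNorm`). Bounding
powers `|u|^{γᵢ}` along lines in each coordinate direction and combining them by Loomis–Whitney
gives `∫ |u|^{(γ₁+γ₂+γ₃)/2} ≤ C ∏ (∫ |u|^{γᵢ-1} |∂ᵢu|)^{1/2}`
(`lintegral_rpow_le_prod_lintegral_coordDeriv`). By Hölder, `∂₃u` is put in `L^a`; `∂₁u` and `∂₂u`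
are put in `L^p` and interpolated by `‖∂ᵢu‖_p² ≤ C ‖u‖_β ‖∂ᵢ²u‖₂` (`eLpNorm_coordDeriv_le`). The
powers of `‖u‖_β` on the right add up to `β - 1` and cancel.

The second is `‖u‖_{2k}^k ≤ C ‖u‖_β^{k-1} H` (`exists_eLpNorm_rpow_le_mul_hessianNorm`): the Sobolev
inequality `W^{1,6/5} ⊂ L²` for `|u|^k`, Hölder, and `‖∇u‖₆ ≤ C H`. Substituting the first
inequality and taking the `k`-th root gives the exponents `s` and `1 - s`.

A general `f ∈ H²` is mollified and cut off (`MemH2.exists_approximation`), and Fatou's lemma passes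
to the limit. If the Hessian vanishes, then `f = 0`, which settles the case `∞ · 0`. -/

open Function Filter Topology

/-! ### Coordinate derivatives and a Loomis–Whitney inequality -/

/-- The directional derivative of `u` along the `i`-th standard basis vector. -/
noncomputable def coordDeriv {F : Type*} [NormedAddCommGroup F] [NormedSpace ℝ F]
    (i : Fin 3) (u : R3 → F)
    (x : R3) : F :=
  fderiv ℝ u x (stdBasis i)

/-- A Loomis–Whitney inequality for three functions on `ℝ³`. -/
theorem lintegral_prod_lintegral_rpow_half_le {g : Fin 3 → (Fin 3 → ℝ) → ℝ≥0∞}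
    (hg : ∀ i, Measurable (g i)) (hfin : ∀ i, ∫⁻ x, g i x ≠ ∞) :
    ∫⁻ x, ∏ i, (∫⁻ t, g i (update x i t)) ^ (1 / 2 : ℝ) ≤
      3 ^ (3 / 2 : ℝ) * ∏ i, (∫⁻ x, g i x) ^ (1 / 2 : ℝ) := by
  -- Each function is to be divided by its integral, which may vanish; adding `ε` makes the divisor
  -- positive, and `ε → 0` at the end.
  have key : ∀ ε : ℝ≥0, 0 < ε → ∫⁻ x, ∏ i, (∫⁻ t, g i (update x i t)) ^ (1 / 2 : ℝ) ≤
      3 ^ (3 / 2 : ℝ) * ∏ i, ((∫⁻ x, g i x) + ε) ^ (1 / 2 : ℝ) := by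
    intro ε hε
    set I : Fin 3 → ℝ≥0∞ := fun i => (∫⁻ x, g i x) + ε with hI
    have hI0 : ∀ i, I i ≠ 0 := fun i => by simp [hI, hε.ne']
    have hIt : ∀ i, I i ≠ ∞ := fun i => by simp [hI, hfin i]
    -- The grid-lines inequality concerns a single function. The sum of the normalised functions
    -- dominates each of them and has integral at most 3, which is the source of the constant `3 ^
    -- (3/2)`.
    set G : (Fin 3 → ℝ) → ℝ≥0∞ := fun x => ∑ i, (I i)⁻¹ * g i x with hG
    have hGm : Measurable G := by fun_prop
    have hGi : ∫⁻ x, G x ≤ 3 := by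
      rw [hG, lintegral_finsetSum _ (by fun_prop)]
      calc ∑ i, ∫⁻ x, (I i)⁻¹ * g i x = ∑ i, (I i)⁻¹ * ∫⁻ x, g i x := by
            congr! 1 with i; rw [lintegral_const_mul _ (hg i)]
        _ ≤ ∑ i : Fin 3, 1 := by
            refine Finset.sum_le_sum fun i _ => ?_
            rw [← ENNReal.inv_mul_cancel (hI0 i) (hIt i)]
            gcongr
            exact le_self_add
        _ = 3 := by simp
    have hle : ∀ i x, g i x ≤ I i * G x := by
      intro i x
      calc g i x = I i * ((I i)⁻¹ * g i x) := by
            rw [← mul_assoc, ENNReal.mul_inv_cancel (hI0 i) (hIt i), one_mul]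
        _ ≤ I i * G x := by
            gcongr
            exact Finset.single_le_sum (f := fun i => (I i)⁻¹ * g i x) (by simp)
              (Finset.mem_univ i)
    have hconj : Real.HolderConjugate (Fintype.card (Fin 3)) (3 / 2 : ℝ) := by
      rw [Real.holderConjugate_iff]; norm_num
    have hgrid := lintegral_prod_lintegral_pow_le (fun _ : Fin 3 => (volume : Measure ℝ))
      hconj hGm
    rw [← volume_pi] at hgrid
    calc ∫⁻ x, ∏ i, (∫⁻ t, g i (update x i t)) ^ (1 / 2 : ℝ)
        ≤ ∫⁻ x, (∏ i, I i ^ (1 / 2 : ℝ)) * ∏ i, (∫⁻ t, G (update x i t)) ^ (1 / 2 : ℝ) := by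
          refine lintegral_mono fun x => ?_
          rw [← Finset.prod_mul_distrib]
          refine Finset.prod_le_prod' fun i _ => ?_
          rw [← ENNReal.mul_rpow_of_nonneg _ _ (by norm_num), ← lintegral_const_mul' _ _ (hIt i)]
          gcongr
          exact hle _ _
      _ = (∏ i, I i ^ (1 / 2 : ℝ)) * ∫⁻ x, ∏ i, (∫⁻ t, G (update x i t)) ^ (1 / 2 : ℝ) := by
          refine lintegral_const_mul' _ _ ?_
          exact ENNReal.prod_ne_top fun i _ => ENNReal.rpow_ne_top_of_nonneg (by norm_num) (hIt i)
      _ ≤ (∏ i, I i ^ (1 / 2 : ℝ)) * 3 ^ (3 / 2 : ℝ) := by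
          gcongr
          refine le_trans (le_of_eq ?_) (hgrid.trans (ENNReal.rpow_le_rpow hGi (by norm_num)))
          norm_num
      _ = _ := mul_comm _ _
  have hlim : Tendsto (fun ε : ℝ≥0 => 3 ^ (3 / 2 : ℝ) * ∏ i, ((∫⁻ x, g i x) + ε) ^ (1 / 2 : ℝ))
      (𝓝[>] 0) (𝓝 (3 ^ (3 / 2 : ℝ) * ∏ i, (∫⁻ x, g i x) ^ (1 / 2 : ℝ))) := by
    have h1 : ∀ i, Tendsto (fun ε : ℝ≥0 => ((∫⁻ x, g i x) + ε) ^ (1 / 2 : ℝ))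
        (𝓝[>] 0) (𝓝 ((∫⁻ x, g i x) ^ (1 / 2 : ℝ))) := by
      intro i
      have : Continuous fun ε : ℝ≥0 => ((∫⁻ x, g i x) + ε) ^ (1 / 2 : ℝ) :=
        ENNReal.continuous_rpow_const.comp (by fun_prop)
      simpa using (this.tendsto 0).mono_left nhdsWithin_le_nhds
    have h2 : ∀ i, (∫⁻ x, g i x) ^ (1 / 2 : ℝ) ≠ ∞ := fun i =>
      ENNReal.rpow_ne_top_of_nonneg (by norm_num) (hfin i)
    have h3 : (3 : ℝ≥0∞) ^ (3 / 2 : ℝ) ≠ ∞ :=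
      ENNReal.rpow_ne_top_of_nonneg (by norm_num) (by norm_num)
    simp only [Fin.prod_univ_three]
    refine ENNReal.Tendsto.const_mul ?_ (Or.inr h3)
    exact ENNReal.Tendsto.mul (ENNReal.Tendsto.mul (h1 0) (Or.inr (h2 1)) (h1 1) (Or.inr (h2 0)))
      (Or.inr (h2 2)) (h1 2) (Or.inr (ENNReal.mul_ne_top (h2 0) (h2 1)))
  refine ge_of_tendsto hlim ?_
  filter_upwards [self_mem_nhdsWithin] with ε hε using key ε hε

/-! ### Powers of a function bounded by line integrals of its derivative -/

section Line

variable {F : Type*} [NormedAddCommGroup F] [InnerProductSpace ℝ F]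

/-- The fundamental theorem of calculus for `‖v‖ ^ γ`. The case `γ = 1` is separate because the norm
need not be differentiable at zeros of `v`; there the theorem is applied to `v` itself. -/
theorem enorm_rpow_le_lintegral_deriv {v : ℝ → F} (hv : ContDiff ℝ 1 v)
    (hc : HasCompactSupport v) {γ : ℝ≥0} (hγ : 1 ≤ γ) (t : ℝ) :
    ‖v t‖ₑ ^ (γ : ℝ) ≤ γ * ∫⁻ τ, ‖v τ‖ₑ ^ ((γ : ℝ) - 1) * ‖deriv v τ‖ₑ := by
  rcases hγ.eq_or_lt with rfl | hγ'
  · simpa using (hc.enorm_le_lintegral_Ici_deriv hv t).trans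
      (lintegral_mono' Measure.restrict_le_self le_rfl)
  · have hγr : (1 : ℝ) < γ := by exact_mod_cast hγ'
    have h1 : ContDiff ℝ 1 (fun τ => ‖v τ‖ ^ (γ : ℝ)) := hv.norm_rpow hγr
    have h2 : HasCompactSupport (fun τ => ‖v τ‖ ^ (γ : ℝ)) :=
      hc.comp_left (g := fun z => ‖z‖ ^ (γ : ℝ)) (by simp [(zero_lt_one.trans hγ').ne'])
    have h3 := (h2.enorm_le_lintegral_Ici_deriv h1 t).trans
      (lintegral_mono' Measure.restrict_le_self le_rfl)
    rw [← lintegral_const_mul' _ _ ENNReal.coe_ne_top]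
    calc ‖v t‖ₑ ^ (γ : ℝ) = ‖‖v t‖ ^ (γ : ℝ)‖ₑ := by
          rw [Real.enorm_rpow_of_nonneg (norm_nonneg _) γ.coe_nonneg, enorm_norm]
      _ ≤ _ := h3
      _ ≤ _ := by
          refine lintegral_mono fun τ => ?_
          have := enorm_fderiv_norm_rpow_le (hv.differentiable one_ne_zero) (x := τ) hγ'
          have e1 : ‖deriv (fun τ => ‖v τ‖ ^ (γ : ℝ)) τ‖ₑ =
              ‖fderiv ℝ (fun τ => ‖v τ‖ ^ (γ : ℝ)) τ‖ₑ := by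
            simp only [enorm, nnnorm, norm_deriv_eq_norm_fderiv]
          have e2 : ‖deriv v τ‖ₑ = ‖fderiv ℝ v τ‖ₑ := by
            simp only [enorm, nnnorm, norm_deriv_eq_norm_fderiv]
          rw [e1, e2, ← mul_assoc]
          exact this

theorem hasDerivAt_toLp_update (y : Fin 3 → ℝ) (i : Fin 3) (t : ℝ) :
    HasDerivAt (fun τ => (WithLp.toLp 2 (update y i τ) : R3)) (stdBasis i) t := by
  have h := hasDerivAt_update (𝕜 := ℝ) y i t
  exact ((PiLp.continuousLinearEquiv 2 ℝ (fun _ : Fin 3 => ℝ)).symm.hasFDerivAt.comp_hasDerivAt t h)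

theorem contDiff_toLp_update (y : Fin 3 → ℝ) (i : Fin 3) :
    ContDiff ℝ 1 (fun τ => (WithLp.toLp 2 (update y i τ) : R3)) :=
  (PiLp.continuousLinearEquiv 2 ℝ (fun _ : Fin 3 => ℝ)).symm.contDiff.comp
    (by convert! contDiff_update 1 y i)

theorem isClosedEmbedding_toLp_update (y : Fin 3 → ℝ) (i : Fin 3) :
    IsClosedEmbedding (fun τ => (WithLp.toLp 2 (update y i τ) : R3)) :=
  (PiLp.continuousLinearEquiv 2 ℝ
    (fun _ : Fin 3 => ℝ)).symm.toHomeomorph.isClosedEmbedding.comp (isClosedEmbedding_update y i)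

theorem enorm_rpow_le_lintegral_coordDeriv {u : R3 → F} (hu : ContDiff ℝ 1 u)
    (hc : HasCompactSupport u) {γ : ℝ≥0} (hγ : 1 ≤ γ) (i : Fin 3) (y : Fin 3 → ℝ) :
    ‖u (WithLp.toLp 2 y)‖ₑ ^ (γ : ℝ) ≤
      γ * ∫⁻ t, ‖u (WithLp.toLp 2 (update y i t))‖ₑ ^ ((γ : ℝ) - 1) *
        ‖coordDeriv i u (WithLp.toLp 2 (update y i t))‖ₑ := by
  have h := enorm_rpow_le_lintegral_deriv (hu.comp (contDiff_toLp_update y i))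
    (hc.comp_isClosedEmbedding (isClosedEmbedding_toLp_update y i)) hγ (y i)
  have hd : ∀ t, deriv (u ∘ fun τ => (WithLp.toLp 2 (update y i τ) : R3)) t =
      coordDeriv i u (WithLp.toLp 2 (update y i t)) := fun t =>
    ((hu.differentiable one_ne_zero _).hasFDerivAt.comp_hasDerivAt t
      (hasDerivAt_toLp_update y i t)).deriv
  simpa [hd] using h

end Line

/-! ### The anisotropic Gagliardo–Nirenberg argument -/

section Gagliardo

variable {F : Type*} [NormedAddCommGroup F] [InnerProductSpace ℝ F]

theorem continuous_coordDeriv {u : R3 → F} (hu : ContDiff ℝ 1 u) (i : Fin 3) :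
    Continuous (coordDeriv i u) :=
  (hu.continuous_fderiv one_ne_zero).clm_apply continuous_const

theorem hasCompactSupport_coordDeriv {u : R3 → F} (hc : HasCompactSupport u) (i : Fin 3) :
    HasCompactSupport (coordDeriv i u) :=
  hc.fderiv_apply ℝ (stdBasis i)

/-- Supplies the finiteness that the three-function Loomis–Whitney inequality requires. -/
theorem lintegral_rpow_mul_coordDeriv_ne_top {u : R3 → F} (hu : ContDiff ℝ 1 u)
    (hc : HasCompactSupport u) {q : ℝ} (hq : 0 ≤ q) (i : Fin 3) :
    ∫⁻ x, ‖u x‖ₑ ^ q * ‖coordDeriv i u x‖ₑ ≠ ∞ := by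
  have hcont : Continuous fun x => ‖u x‖ ^ q * ‖coordDeriv i u x‖ :=
    (hu.continuous.norm.rpow_const fun _ => Or.inr hq).mul (continuous_coordDeriv hu i).norm
  have hcs : HasCompactSupport fun x => ‖u x‖ ^ q * ‖coordDeriv i u x‖ :=
    (hasCompactSupport_coordDeriv hc i).norm.mul_left
  have hInt := (hcont.integrable_of_hasCompactSupport (μ := volume) hcs).2
  rw [hasFiniteIntegral_iff_enorm] at hInt
  refine (lt_of_le_of_lt (le_of_eq ?_) hInt).ne
  refine lintegral_congr fun x => ?_
  rw [enorm_mul, Real.enorm_rpow_of_nonneg (norm_nonneg _) hq, enorm_norm, enorm_norm]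

/-- An anisotropic form of the Gagliardo–Nirenberg argument. -/
theorem lintegral_rpow_le_prod_lintegral_coordDeriv {u : R3 → F} (hu : ContDiff ℝ 1 u)
    (hc : HasCompactSupport u) {γ : Fin 3 → ℝ≥0} (hγ : ∀ i, 1 ≤ γ i) :
    ∫⁻ x, ‖u x‖ₑ ^ ((∑ i, (γ i : ℝ)) / 2) ≤
      3 ^ (3 / 2 : ℝ) * ∏ i, (γ i * ∫⁻ x, ‖u x‖ₑ ^ ((γ i : ℝ) - 1) * ‖coordDeriv i u x‖ₑ)
        ^ (1 / 2 : ℝ) := by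
  have hmp := PiLp.volume_preserving_toLp (Fin 3)
  have hγ' : ∀ i, (0 : ℝ) ≤ γ i - 1 := fun i => sub_nonneg.2 (by exact_mod_cast hγ i)
  set g : Fin 3 → R3 → ℝ≥0∞ := fun i x => γ i * (‖u x‖ₑ ^ ((γ i : ℝ) - 1) * ‖coordDeriv i u x‖ₑ)
    with hg
  have hgm : ∀ i, Measurable (g i) := fun i =>
    (((hu.continuous.enorm).measurable.pow_const _).mul
      (continuous_coordDeriv hu i).enorm.measurable).const_mul _
  have hgI : ∀ i, ∫⁻ x, g i x = γ i * ∫⁻ x, ‖u x‖ₑ ^ ((γ i : ℝ) - 1) * ‖coordDeriv i u x‖ₑ :=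
    fun i => lintegral_const_mul' _ _ ENNReal.coe_ne_top
  have hgy : ∀ i, ∫⁻ y, g i (WithLp.toLp 2 y) = ∫⁻ x, g i x := fun i =>
    hmp.lintegral_comp (hgm i)
  simp only [← hgI, ← hgy]
  rw [← hmp.lintegral_comp (hu.continuous.enorm.measurable.pow_const _)]
  refine le_trans (lintegral_mono fun y => ?_)
    (lintegral_prod_lintegral_rpow_half_le (g := fun i y => g i (WithLp.toLp 2 y))
      (fun i => (hgm i).comp hmp.measurable) (fun i => ?_))
  · have : ‖u (WithLp.toLp 2 y)‖ₑ ^ ((∑ i, (γ i : ℝ)) / 2) =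
        ∏ i, (‖u (WithLp.toLp 2 y)‖ₑ ^ (γ i : ℝ)) ^ (1 / 2 : ℝ) := by
      simp only [Fin.prod_univ_three, Fin.sum_univ_three, ← ENNReal.rpow_mul]
      rw [← ENNReal.rpow_add_of_nonneg _ _ (by positivity) (by positivity),
        ← ENNReal.rpow_add_of_nonneg _ _ (by positivity) (by positivity)]
      congr 1; ring
    rw [this]
    refine Finset.prod_le_prod' fun i _ => ENNReal.rpow_le_rpow ?_ (by norm_num)
    simp only [hg]
    rw [lintegral_const_mul' _ _ ENNReal.coe_ne_top]
    exact enorm_rpow_le_lintegral_coordDeriv hu hc (hγ i) i y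
  · rw [hgy, hgI]
    exact ENNReal.mul_ne_top ENNReal.coe_ne_top
      (lintegral_rpow_mul_coordDeriv_ne_top hu hc (hγ' i) i)

end Gagliardo

/-! ### Hölder inequalities and cancellation of powers -/

section Holder

variable {α F G H : Type*} [MeasurableSpace α] {μ : Measure α} [NormedAddCommGroup F]
  [NormedAddCommGroup G] [NormedAddCommGroup H]

theorem lintegral_enorm_rpow_eq (f : α → F) {p : ℝ} (hp : 0 < p) :
    ∫⁻ x, ‖f x‖ₑ ^ p ∂μ = eLpNorm f (ENNReal.ofReal p) μ ^ p := by
  rw [eLpNorm_eq_eLpNorm' (by simpa using hp) (by simp), ENNReal.toReal_ofReal hp.le,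
    lintegral_rpow_enorm_eq_rpow_eLpNorm' hp]

/-- Hölder's inequality for a product of powers of three functions. -/
theorem lintegral_enorm_rpow_mul_mul_le {f : α → F} {g : α → G} {h : α → H}
    (hf : AEStronglyMeasurable f μ) (hg : AEStronglyMeasurable g μ)
    (hh : AEStronglyMeasurable h μ) {p₁ p₂ p₃ q₁ q₂ q₃ : ℝ} (hp₁ : 0 < p₁) (hp₂ : 0 < p₂)
    (hp₃ : 0 < p₃) (hq₁ : 0 ≤ q₁) (hq₂ : 0 ≤ q₂) (hq₃ : 0 ≤ q₃)
    (hsum : q₁ / p₁ + q₂ / p₂ + q₃ / p₃ = 1) :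
    ∫⁻ x, ‖f x‖ₑ ^ q₁ * ‖g x‖ₑ ^ q₂ * ‖h x‖ₑ ^ q₃ ∂μ ≤
      eLpNorm f (ENNReal.ofReal p₁) μ ^ q₁ * eLpNorm g (ENNReal.ofReal p₂) μ ^ q₂ *
        eLpNorm h (ENNReal.ofReal p₃) μ ^ q₃ := by
  have key := ENNReal.lintegral_prod_norm_pow_le (μ := μ) Finset.univ
    (f := ![fun x => ‖f x‖ₑ ^ p₁, fun x => ‖g x‖ₑ ^ p₂, fun x => ‖h x‖ₑ ^ p₃])
    (p := ![q₁ / p₁, q₂ / p₂, q₃ / p₃])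
    (by
      intro i _
      fin_cases i
      · exact hf.enorm.pow_const _
      · exact hg.enorm.pow_const _
      · exact hh.enorm.pow_const _)
    (by simpa [Fin.sum_univ_three] using hsum)
    (by
      intro i _
      fin_cases i
      · exact div_nonneg hq₁ hp₁.le
      · exact div_nonneg hq₂ hp₂.le
      · exact div_nonneg hq₃ hp₃.le)
  simpa [Fin.prod_univ_three, ← ENNReal.rpow_mul, lintegral_enorm_rpow_eq, hp₁, hp₂, hp₃,
    mul_div_cancel₀, hp₁.ne', hp₂.ne', hp₃.ne'] using key

theorem lintegral_enorm_rpow_mul_le {f : α → F} {g : α → G}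
    (hf : AEStronglyMeasurable f μ) (hg : AEStronglyMeasurable g μ)
    {p₁ p₂ q₁ q₂ : ℝ} (hp₁ : 0 < p₁) (hp₂ : 0 < p₂) (hq₁ : 0 ≤ q₁) (hq₂ : 0 ≤ q₂)
    (hsum : q₁ / p₁ + q₂ / p₂ = 1) :
    ∫⁻ x, ‖f x‖ₑ ^ q₁ * ‖g x‖ₑ ^ q₂ ∂μ ≤
      eLpNorm f (ENNReal.ofReal p₁) μ ^ q₁ * eLpNorm g (ENNReal.ofReal p₂) μ ^ q₂ := by
  simpa using lintegral_enorm_rpow_mul_mul_le hf hg hf hp₁ hp₂ zero_lt_one hq₁ hq₂ le_rfl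
    (by simpa using hsum)

/-- The absorption step of both a priori estimates: a norm appearing on both sides is cancelled. In
`ℝ≥0∞` this needs it to be nonzero and finite, hence the case splits and compact supports below. -/
theorem ENNReal.rpow_le_of_rpow_add_le_mul {U K : ℝ≥0∞} (hU₀ : U ≠ 0) (hU : U ≠ ∞) {x y : ℝ}
    (h : U ^ (x + y) ≤ U ^ x * K) : U ^ y ≤ K := by
  rw [ENNReal.rpow_add _ _ hU₀ hU] at h
  exact (ENNReal.mul_le_mul_iff_right (ENNReal.rpow_pos (pos_iff_ne_zero.2 hU₀) hU).ne'
    (ENNReal.rpow_ne_top_of_ne_zero hU₀ hU)).1 h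

end Holder

/-! ### Interpolation of first derivatives by integration by parts -/

section IntegrationByParts

theorem hasDerivAt_abs_rpow_mul_self (x : ℝ) {q : ℝ} (hq : 0 ≤ q) :
    HasDerivAt (fun x : ℝ => |x| ^ q * x) ((q + 1) * |x| ^ q) x := by
  rcases hq.eq_or_lt with rfl | hq
  · simpa using hasDerivAt_id' x
  rcases eq_or_ne x 0 with rfl | hx
  · rw [hasDerivAt_iff_tendsto_slope_zero]
    -- The difference quotient at the origin is exactly `|t| ^ q`, which tends to 0 as `q > 0`.
    have h1 : Tendsto (fun t : ℝ => |t| ^ q) (𝓝[≠] 0) (𝓝 ((q + 1) * |(0 : ℝ)| ^ q)) := by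
      have : Continuous fun t : ℝ => |t| ^ q :=
        continuous_abs.rpow_const fun _ => Or.inr hq.le
      simpa [Real.zero_rpow hq.ne'] using (this.tendsto 0).mono_left nhdsWithin_le_nhds
    refine h1.congr' ?_
    filter_upwards [self_mem_nhdsWithin] with t ht
    have ht : t ≠ 0 := ht
    simp
    field_simp
  · have h := (((hasDerivAt_abs hx).rpow_const (p := q) (Or.inl (abs_ne_zero.2 hx))).mul
      (hasDerivAt_id x))
    convert! h using 1
    have h2 : |x| ^ q = |x| ^ (q - 1) * |x| := by
      rw [← Real.rpow_add_one (abs_ne_zero.2 hx)]; ring_nf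
    have h3 : (SignType.sign x : ℝ) * x = |x| := by
      rw [mul_comm]; exact self_mul_sign x
    simp only [id]
    rw [h2, ← h3]
    ring

theorem contDiff_coordDeriv {F : Type*} [NormedAddCommGroup F] [NormedSpace ℝ F] {u : R3 → F}
    (hu : ContDiff ℝ 2 u) (i : Fin 3) : ContDiff ℝ 1 (coordDeriv i u) :=
  (hu.fderiv_right (m := 1) (by norm_num)).clm_apply contDiff_const

/-- With `w = ∂ᵢu`, write `|w|^{q+2} = ∂ᵢu · (|w|^q w)` and move `∂ᵢ` onto the second factor, whose
derivative is `(q+1) |w|^q ∂ᵢw`. -/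
theorem lintegral_coordDeriv_rpow_le {u : R3 → ℝ} (hu : ContDiff ℝ 2 u)
    (hc : HasCompactSupport u) {q : ℝ} (hq : 0 ≤ q) (i : Fin 3) :
    ∫⁻ x, ‖coordDeriv i u x‖ₑ ^ (q + 2) ≤ ENNReal.ofReal (q + 1) *
      ∫⁻ x, ‖u x‖ₑ * ‖coordDeriv i u x‖ₑ ^ q * ‖coordDeriv i (coordDeriv i u) x‖ₑ := by
  set w := coordDeriv i u with hw
  have hwC : ContDiff ℝ 1 w := contDiff_coordDeriv hu i
  have hwc : HasCompactSupport w := hasCompactSupport_coordDeriv hc i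
  set ψ : R3 → ℝ := fun x => |w x| ^ q * w x with hψ
  have hψd : ∀ x, HasFDerivAt ψ (((q + 1) * |w x| ^ q) • fderiv ℝ w x) x := fun x =>
    (hasDerivAt_abs_rpow_mul_self (w x) hq).comp_hasFDerivAt x
      (hwC.differentiable one_ne_zero x).hasFDerivAt
  have habs : Continuous fun x => |w x| ^ q :=
    hwC.continuous.abs.rpow_const fun _ => Or.inr hq
  have hψc : Continuous ψ := habs.mul hwC.continuous
  have hψ' : ∀ x, fderiv ℝ ψ x (stdBasis i) = (q + 1) * |w x| ^ q * coordDeriv i w x := fun x => by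
    rw [(hψd x).fderiv]; rfl
  have hibp : ∫ x, u x * fderiv ℝ ψ x (stdBasis i) = -∫ x, fderiv ℝ u x (stdBasis i) * ψ x := by
    refine integral_mul_fderiv_eq_neg_fderiv_mul_of_integrable ?_ ?_ ?_
      (fun x _ => hu.differentiable two_ne_zero x) (fun x _ => (hψd x).differentiableAt)
    · exact (hwC.continuous.mul hψc).integrable_of_hasCompactSupport hwc.mul_right
    · simp only [hψ']
      exact (hu.continuous.mul ((continuous_const.mul habs).mul
        (continuous_coordDeriv hwC i))).integrable_of_hasCompactSupport hc.mul_right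
    · exact (hu.continuous.mul hψc).integrable_of_hasCompactSupport hc.mul_right
  have hpos : ∀ x, fderiv ℝ u x (stdBasis i) * ψ x = |w x| ^ (q + 2) := fun x => by
    change w x * (|w x| ^ q * w x) = _
    rcases eq_or_ne (w x) 0 with h | h
    · simp [h, Real.zero_rpow (by linarith : q + 2 ≠ 0)]
    · rw [Real.rpow_add (abs_pos.2 h), Real.rpow_two, sq_abs]; ring
  simp only [hpos] at hibp
  have hInt : Integrable (fun x => |w x| ^ (q + 2)) := by
    simp only [← hpos]
    exact (hwC.continuous.mul hψc).integrable_of_hasCompactSupport hwc.mul_right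
  calc ∫⁻ x, ‖w x‖ₑ ^ (q + 2) = ∫⁻ x, ENNReal.ofReal (|w x| ^ (q + 2)) := by
        refine lintegral_congr fun x => ?_
        rw [← ENNReal.ofReal_rpow_of_nonneg (abs_nonneg _) (by linarith), ← Real.norm_eq_abs,
          ofReal_norm]
    _ = ENNReal.ofReal (∫ x, |w x| ^ (q + 2)) :=
        (ofReal_integral_eq_lintegral_ofReal hInt
          (Eventually.of_forall fun x => by positivity)).symm
    _ ≤ ‖∫ x, |w x| ^ (q + 2)‖ₑ := Real.ofReal_le_enorm _
    _ = ‖∫ x, u x * fderiv ℝ ψ x (stdBasis i)‖ₑ := by rw [hibp, enorm_neg]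
    _ ≤ ∫⁻ x, ‖u x * fderiv ℝ ψ x (stdBasis i)‖ₑ := enorm_integral_le_lintegral_enorm _
    _ = ∫⁻ x, ENNReal.ofReal (q + 1) * (‖u x‖ₑ * ‖w x‖ₑ ^ q * ‖coordDeriv i w x‖ₑ) := by
        refine lintegral_congr fun x => ?_
        rw [hψ', enorm_mul, enorm_mul, enorm_mul, Real.enorm_rpow_of_nonneg (abs_nonneg _) hq,
          Real.enorm_abs, Real.enorm_of_nonneg (by linarith : 0 ≤ q + 1)]
        ring
    _ = _ := lintegral_const_mul' _ _ ENNReal.ofReal_ne_top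

/-- Integration by parts with `q = p - 2`, then Hölder with exponents `b`, `p`, `2`: `D^p ≤ (p-1)
D^{p-2} ‖u‖_b ‖∂ᵢ²u‖₂` for `D = ‖∂ᵢu‖_p`, and `D^{p-2}` cancels. -/
theorem eLpNorm_coordDeriv_le_real {u : R3 → ℝ} (hu : ContDiff ℝ 2 u)
    (hc : HasCompactSupport u) {p b : ℝ} (hp : 2 ≤ p) (hb : 0 < b) (hpb : 2 / p = 1 / b + 1 / 2)
    (i : Fin 3) :
    eLpNorm (coordDeriv i u) (ENNReal.ofReal p) volume ≤
      (ENNReal.ofReal (p - 1) * eLpNorm u (ENNReal.ofReal b) volume *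
        eLpNorm (coordDeriv i (coordDeriv i u)) 2 volume) ^ (1 / 2 : ℝ) := by
  have hp0 : 0 < p := by linarith
  have hwC : ContDiff ℝ 1 (coordDeriv i u) := contDiff_coordDeriv hu i
  have hwc : HasCompactSupport (coordDeriv i u) := hasCompactSupport_coordDeriv hc i
  set D := eLpNorm (coordDeriv i u) (ENNReal.ofReal p) volume with hD
  have hDt : D ≠ ∞ := (hwC.continuous.memLp_of_hasCompactSupport hwc).2.ne
  rcases eq_or_ne D 0 with h0 | h0
  · simp [h0]
  have h1 := lintegral_coordDeriv_rpow_le hu hc (q := p - 2) (by linarith) i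
  rw [show p - 2 + 2 = p by ring, show p - 2 + 1 = p - 1 by ring,
    lintegral_enorm_rpow_eq _ hp0] at h1
  have h2 := lintegral_enorm_rpow_mul_mul_le (μ := volume) hu.continuous.aestronglyMeasurable
    hwC.continuous.aestronglyMeasurable (continuous_coordDeriv hwC i).aestronglyMeasurable
    hb hp0 (two_pos) zero_le_one (by linarith : 0 ≤ p - 2) zero_le_one (by
      rw [sub_div, hpb, div_self hp0.ne']; ring)
  simp only [ENNReal.rpow_one, ENNReal.ofReal_ofNat] at h2
  have h3 : D ^ ((p - 2) + 2) ≤ D ^ (p - 2) * (ENNReal.ofReal (p - 1) *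
      eLpNorm u (ENNReal.ofReal b) volume *
        eLpNorm (coordDeriv i (coordDeriv i u)) 2 volume) := by
    rw [sub_add_cancel]
    refine (h1.trans (mul_le_mul_right h2 _)).trans (le_of_eq ?_)
    rw [← hD]; ring
  have h4 := ENNReal.rpow_le_of_rpow_add_le_mul h0 hDt h3
  calc D = (D ^ (2 : ℝ)) ^ (1 / 2 : ℝ) := by rw [← ENNReal.rpow_mul]; norm_num
    _ ≤ _ := ENNReal.rpow_le_rpow h4 (by norm_num)

theorem coordDeriv_clm_comp {F G : Type*} [NormedAddCommGroup F] [NormedSpace ℝ F]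
    [NormedAddCommGroup G] [NormedSpace ℝ G] (L : F →L[ℝ] G) {u : R3 → F}
    (hu : Differentiable ℝ u) (i : Fin 3) :
    coordDeriv i (fun x => L (u x)) = fun x => L (coordDeriv i u x) := by
  ext x
  have := (L.hasFDerivAt.comp x (hu x).hasFDerivAt).fderiv
  simp only [coordDeriv]
  exact DFunLike.congr_fun this _

/-- Interpolation of a first derivative between the function and its second derivative. -/
theorem eLpNorm_coordDeriv_le {u : R3 → ℂ} (hu : ContDiff ℝ 2 u)
    (hc : HasCompactSupport u) {p b : ℝ} (hp : 2 ≤ p) (hb : 0 < b) (hpb : 2 / p = 1 / b + 1 / 2)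
    (i : Fin 3) :
    eLpNorm (coordDeriv i u) (ENNReal.ofReal p) volume ≤
      2 * (ENNReal.ofReal (p - 1) * eLpNorm u (ENNReal.ofReal b) volume *
        eLpNorm (coordDeriv i (coordDeriv i u)) 2 volume) ^ (1 / 2 : ℝ) := by
  have hwC : ContDiff ℝ 1 (coordDeriv i u) := contDiff_coordDeriv hu i
  -- The integration by parts is for real functions; it is applied to the real and imaginary parts,
  -- and adding the two bounds gives the factor 2.
  have key : ∀ L : ℂ →L[ℝ] ℝ, (∀ z, |L z| ≤ ‖z‖) →
      eLpNorm (fun x => L (coordDeriv i u x)) (ENNReal.ofReal p) volume ≤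
      (ENNReal.ofReal (p - 1) * eLpNorm u (ENNReal.ofReal b) volume *
        eLpNorm (coordDeriv i (coordDeriv i u)) 2 volume) ^ (1 / 2 : ℝ) := by
    intro L hL
    have h := eLpNorm_coordDeriv_le_real (L.contDiff.comp hu) (hc.comp_left (map_zero L)) hp hb
      hpb i
    have e1 : coordDeriv i (L ∘ u) = fun x => L (coordDeriv i u x) :=
      coordDeriv_clm_comp L (hu.differentiable two_ne_zero) i
    rw [e1, coordDeriv_clm_comp L (hwC.differentiable one_ne_zero)] at h
    refine h.trans ?_
    gcongr
    · exact eLpNorm_mono fun x => hL _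
    · exact eLpNorm_mono fun x => hL _
  have hre := key Complex.reCLM Complex.abs_re_le_norm
  have him := key Complex.imCLM Complex.abs_im_le_norm
  rw [two_mul]
  refine le_trans ?_ (add_le_add hre him)
  have hcr : Continuous fun x => Complex.reCLM (coordDeriv i u x) :=
    Complex.reCLM.continuous.comp hwC.continuous
  have hci : Continuous fun x => Complex.imCLM (coordDeriv i u x) :=
    Complex.imCLM.continuous.comp hwC.continuous
  rw [← eLpNorm_norm (fun x => Complex.reCLM (coordDeriv i u x)),
    ← eLpNorm_norm (fun x => Complex.imCLM (coordDeriv i u x))]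
  refine le_trans ?_ (eLpNorm_add_le hcr.norm.aestronglyMeasurable hci.norm.aestronglyMeasurable
    (by rw [ENNReal.one_le_ofReal]; linarith))
  refine eLpNorm_mono_real fun x => ?_
  simpa using Complex.norm_le_abs_re_add_abs_im _

end IntegrationByParts

/-! ### The inequality for compactly supported C² functions -/

section Smooth

theorem norm_le_sum_norm_stdBasis {F : Type*} [NormedAddCommGroup F] [NormedSpace ℝ F]
    (L : R3 →L[ℝ] F) : ‖L‖ ≤ ∑ i, ‖L (stdBasis i)‖ := by
  refine L.opNorm_le_bound (by positivity) fun v => ?_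
  have hv : v = ∑ i, v i • stdBasis i := by
    ext j; simp [stdBasis, Finset.sum_apply, Pi.single_apply]
  calc ‖L v‖ = ‖∑ i, v i • L (stdBasis i)‖ := by
        conv_lhs => rw [hv]
        simp only [map_sum, map_smul]
    _ ≤ ∑ i, ‖v i • L (stdBasis i)‖ := norm_sum_le _ _
    _ ≤ ∑ i, ‖L (stdBasis i)‖ * ‖v‖ := by
        refine Finset.sum_le_sum fun i _ => ?_
        rw [norm_smul, mul_comm]
        gcongr
        exact PiLp.norm_apply_le v i
    _ = _ := by rw [Finset.sum_mul]

theorem eLpNorm_fderiv_le_sum {F : Type*} [NormedAddCommGroup F] [InnerProductSpace ℝ F]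
    {u : R3 → F} (hu : ContDiff ℝ 1 u) {p : ℝ≥0∞} (hp : 1 ≤ p) :
    eLpNorm (fderiv ℝ u) p volume ≤ ∑ i, eLpNorm (coordDeriv i u) p volume := by
  calc eLpNorm (fderiv ℝ u) p volume
      ≤ eLpNorm (∑ i, fun x => ‖coordDeriv i u x‖) p volume := by
        refine eLpNorm_mono_real fun x => ?_
        simpa [coordDeriv] using norm_le_sum_norm_stdBasis (fderiv ℝ u x)
    _ ≤ ∑ i, eLpNorm (fun x => ‖coordDeriv i u x‖) p volume :=
        eLpNorm_sum_le (fun i _ => (continuous_coordDeriv hu i).norm.aestronglyMeasurable) hp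
    _ = _ := by simp only [eLpNorm_norm]

/-- The sum of the `L²` norms of all second order partial derivatives. -/
noncomputable def hessianNorm (u : R3 → ℂ) : ℝ≥0∞ :=
  ∑ j, ∑ i, eLpNorm (coordDeriv i (coordDeriv j u)) 2 volume

theorem eLpNorm_coordDeriv_coordDeriv_le_hessianNorm (u : R3 → ℂ) (i j : Fin 3) :
    eLpNorm (coordDeriv i (coordDeriv j u)) 2 volume ≤ hessianNorm u :=
  (Finset.single_le_sum (f := fun i => eLpNorm (coordDeriv i (coordDeriv j u)) 2 volume)
    (by simp) (Finset.mem_univ i)).trans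
  (Finset.single_le_sum
    (f := fun j => ∑ i, eLpNorm (coordDeriv i (coordDeriv j u)) 2 volume)
    (by simp) (Finset.mem_univ j))

theorem finrank_R3 : (Module.finrank ℝ R3 : ℝ) = 3 := by simp

/-- An anisotropic Sobolev inequality in which `∂₃ u` and the Hessian enter symmetrically. -/
theorem exists_eLpNorm_le_coordDeriv_mul_hessianNorm {a β : ℝ} (hβ : 4 ≤ β) (ha : 0 < a)
    (haβ : 1 / a = 1 / 2 + 2 / β) :
    ∃ C : ℝ≥0, ∀ u : R3 → ℂ, ContDiff ℝ 2 u → HasCompactSupport u →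
      eLpNorm u (ENNReal.ofReal β) volume ≤
        C * (eLpNorm (coordDeriv 2 u) (ENNReal.ofReal a) volume * hessianNorm u) ^ (1 / 2 : ℝ) := by
  have hβ0 : 0 < β := by linarith
  obtain ⟨p, hp2, hp⟩ : ∃ p : ℝ, 2 ≤ p ∧ 2 / p = 1 / β + 1 / 2 := by
    refine ⟨2 / (1 / β + 1 / 2), ?_, by field_simp⟩
    rw [le_div_iff₀ (by positivity)]
    have : 1 / β ≤ 1 / 4 := one_div_le_one_div_of_le (by norm_num) hβ
    linarith
  have hp0 : 0 < p := by linarith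
  -- The exponents are forced by Hölder: `(γ₁-1)/β + 1/p = 1` and `(γ₃-1)/β + 1/a = 1`. Then
  -- `(2γ₁+γ₃)/2 = β`, so the left side is again the `L^β` norm, and `γ₃ ≥ 1` is exactly `β ≥ 4`.
  obtain ⟨γ₁, hγ₁⟩ : ∃ γ : ℝ≥0, (γ : ℝ) = 1 / 2 + 3 * β / 4 := ⟨⟨_, by positivity⟩, rfl⟩
  obtain ⟨γ₃, hγ₃⟩ : ∃ γ : ℝ≥0, (γ : ℝ) = β / 2 - 1 := ⟨⟨_, by linarith⟩, rfl⟩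
  have hγ₁' : 1 ≤ γ₁ := by rw [← NNReal.coe_le_coe, hγ₁]; push_cast; linarith
  have hγ₃' : 1 ≤ γ₃ := by rw [← NNReal.coe_le_coe, hγ₃]; push_cast; linarith
  set c : ℝ≥0∞ := ENNReal.ofReal (p - 1) with hc
  set K : ℝ≥0∞ := 3 ^ (3 / 2 : ℝ) * γ₁ * 2 * c ^ (1 / 2 : ℝ) * (γ₃ : ℝ≥0∞) ^ (1 / 2 : ℝ) with hK
  have hKt : K ≠ ∞ := by
    have h3 : (3 : ℝ≥0∞) ^ (3 / 2 : ℝ) ≠ ∞ :=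
      ENNReal.rpow_ne_top_of_nonneg (by norm_num) (by norm_num)
    have h4 : c ^ (1 / 2 : ℝ) ≠ ∞ :=
      ENNReal.rpow_ne_top_of_nonneg (by norm_num) ENNReal.ofReal_ne_top
    have h5 : (γ₃ : ℝ≥0∞) ^ (1 / 2 : ℝ) ≠ ∞ :=
      ENNReal.rpow_ne_top_of_nonneg (by norm_num) ENNReal.coe_ne_top
    exact ENNReal.mul_ne_top (ENNReal.mul_ne_top (ENNReal.mul_ne_top (ENNReal.mul_ne_top h3
      ENNReal.coe_ne_top) (by norm_num)) h4) h5
  refine ⟨K.toNNReal, fun u hu hcs => ?_⟩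
  rw [ENNReal.coe_toNNReal hKt]
  have hu1 : ContDiff ℝ 1 u := hu.of_le (by norm_num)
  set U := eLpNorm u (ENNReal.ofReal β) volume with hU
  set A := eLpNorm (coordDeriv 2 u) (ENNReal.ofReal a) volume with hA
  set H := hessianNorm u with hH
  have hUt : U ≠ ∞ := (hu.continuous.memLp_of_hasCompactSupport hcs).2.ne
  rcases eq_or_ne U 0 with h0 | h0
  · simp [h0]
  have hgag := lintegral_rpow_le_prod_lintegral_coordDeriv hu1 hcs (γ := ![γ₁, γ₁, γ₃])
    (by intro i; fin_cases i <;> simpa)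
  have hsum : (∑ i, ((![γ₁, γ₁, γ₃] i : ℝ≥0) : ℝ)) / 2 = β := by
    simp [Fin.sum_univ_three, hγ₁, hγ₃]; ring
  rw [hsum, lintegral_enorm_rpow_eq _ hβ0] at hgag
  simp only [Fin.prod_univ_three, Matrix.cons_val_zero, Matrix.cons_val_one,
    Matrix.cons_val] at hgag
  have hI : ∀ i, ∫⁻ x, ‖u x‖ₑ ^ ((γ₁ : ℝ) - 1) * ‖coordDeriv i u x‖ₑ ≤
      U ^ ((γ₁ : ℝ) - 1) * (2 * (c * U * H) ^ (1 / 2 : ℝ)) := by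
    intro i
    have h1 := lintegral_enorm_rpow_mul_le (μ := volume) hu.continuous.aestronglyMeasurable
      (continuous_coordDeriv hu1 i).aestronglyMeasurable hβ0 hp0
      (by rw [hγ₁]; linarith : 0 ≤ (γ₁ : ℝ) - 1) zero_le_one (by
        have : 1 / p = (1 / β + 1 / 2) / 2 := by rw [← hp]; ring
        rw [this, hγ₁]; field_simp; ring)
    simp only [ENNReal.rpow_one] at h1
    refine h1.trans ?_
    gcongr
    refine (eLpNorm_coordDeriv_le hu hcs hp2 hβ0 hp i).trans ?_
    gcongr
    exact eLpNorm_coordDeriv_coordDeriv_le_hessianNorm u i i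
  have hI3 : ∫⁻ x, ‖u x‖ₑ ^ ((γ₃ : ℝ) - 1) * ‖coordDeriv 2 u x‖ₑ ≤ U ^ ((γ₃ : ℝ) - 1) * A := by
    have h1 := lintegral_enorm_rpow_mul_le (μ := volume) hu.continuous.aestronglyMeasurable
      (continuous_coordDeriv hu1 2).aestronglyMeasurable hβ0 ha
      (by rw [hγ₃]; linarith : 0 ≤ (γ₃ : ℝ) - 1) zero_le_one (by
        rw [haβ, hγ₃]; field_simp; ring)
    simpa only [ENNReal.rpow_one] using h1
  have hmain : U ^ ((β - 1) + 1) ≤ U ^ (β - 1) * (K * (A * H) ^ (1 / 2 : ℝ)) := by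
    rw [sub_add_cancel]
    calc U ^ β ≤ _ := hgag
      _ ≤ 3 ^ (3 / 2 : ℝ) * ((γ₁ * (U ^ ((γ₁ : ℝ) - 1) * (2 * (c * U * H) ^ (1 / 2 : ℝ))))
            ^ (1 / 2 : ℝ) *
          (γ₁ * (U ^ ((γ₁ : ℝ) - 1) * (2 * (c * U * H) ^ (1 / 2 : ℝ)))) ^ (1 / 2 : ℝ) *
          (γ₃ * (U ^ ((γ₃ : ℝ) - 1) * A)) ^ (1 / 2 : ℝ)) := by
          gcongr
          · exact hI 0
          · exact hI 1
      _ = 3 ^ (3 / 2 : ℝ) * ((γ₁ * (U ^ ((γ₁ : ℝ) - 1) * (2 * (c * U * H) ^ (1 / 2 : ℝ)))) *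
          (γ₃ * (U ^ ((γ₃ : ℝ) - 1) * A)) ^ (1 / 2 : ℝ)) := by
          congr 2
          rw [← ENNReal.rpow_add_of_nonneg _ _ (by norm_num) (by norm_num)]
          norm_num
      _ = U ^ (β - 1) * (K * (A * H) ^ (1 / 2 : ℝ)) := by
          -- The total power of `U` on the right: two Hölder factors of power `1/2` each for
          -- directions 1 and 2, the interpolation of the derivative, and direction 3.
          have hx : U ^ (β - 1) = U ^ ((γ₁ : ℝ) - 1) * U ^ (1 / 2 : ℝ) *
              U ^ (((γ₃ : ℝ) - 1) * (1 / 2)) := by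
            rw [← ENNReal.rpow_add _ _ h0 hUt, ← ENNReal.rpow_add _ _ h0 hUt, hγ₁, hγ₃]
            congr 1; ring
          simp only [ENNReal.mul_rpow_of_nonneg _ _ (by norm_num : (0 : ℝ) ≤ 1 / 2)]
          rw [hx, hK, ← ENNReal.rpow_mul U]
          ring
  simpa using ENNReal.rpow_le_of_rpow_add_le_mul h0 hUt hmain

/-- The Sobolev inequality `‖w‖₆ ≤ C ‖∇w‖₂` in dimension three, applied to each `w = ∂ⱼu`. -/
theorem exists_eLpNorm_fderiv_six_le :
    ∃ C : ℝ≥0, ∀ u : R3 → ℂ, ContDiff ℝ 2 u → HasCompactSupport u →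
      eLpNorm (fderiv ℝ u) 6 volume ≤ C * hessianNorm u := by
  refine ⟨SNormLESNormFDerivOfEqConst ℂ (volume : Measure R3) (2 : ℝ≥0), fun u hu hc => ?_⟩
  have hu1 : ContDiff ℝ 1 u := hu.of_le (by norm_num)
  refine (eLpNorm_fderiv_le_sum hu1 (by norm_num)).trans ?_
  rw [hessianNorm, Finset.mul_sum]
  refine Finset.sum_le_sum fun j _ => ?_
  have hw := contDiff_coordDeriv hu j
  have h := eLpNorm_le_eLpNorm_fderiv_of_eq (μ := (volume : Measure R3)) (F := ℂ) hw
    (hasCompactSupport_coordDeriv hc j) (p := 2) (p' := 6) (by norm_num) (by simp)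
    (by rw [finrank_R3]; norm_num)
  refine h.trans ?_
  gcongr
  rw [ENNReal.coe_ofNat]
  exact eLpNorm_fderiv_le_sum hw (by norm_num)

/-- The Sobolev inequality from `L^{6/5}` to `L²` for `|u|^k`, whose gradient is at most `k
|u|^{k-1} |∇u|`. Hölder with `u ∈ L^β` and `∇u ∈ L⁶` needs `(k-1)/β + 1/6 = 5/6`, which is the
hypothesis on `k`. -/
theorem exists_eLpNorm_rpow_le_mul_hessianNorm {β k : ℝ} (hβ : 0 < β) (hk : k = 1 + 2 * β / 3) :
    ∃ C : ℝ≥0, ∀ u : R3 → ℂ, ContDiff ℝ 2 u → HasCompactSupport u →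
      eLpNorm u (ENNReal.ofReal (2 * k)) volume ^ k ≤
        C * (eLpNorm u (ENNReal.ofReal β) volume ^ (k - 1) * hessianNorm u) := by
  obtain ⟨C₁, hC₁⟩ := exists_eLpNorm_fderiv_six_le
  have hk1 : 1 < k := by rw [hk]; linarith
  have hk0 : 0 < k := by linarith
  lift k to ℝ≥0 using hk0.le
  refine ⟨SNormLESNormFDerivOfEqConst ℝ (volume : Measure R3) (6 / 5 : ℝ≥0) * (k * C₁),
    fun u hu hc => ?_⟩
  have hu1 : ContDiff ℝ 1 u := hu.of_le (by norm_num)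
  have h := eLpNorm_le_eLpNorm_fderiv_of_eq (μ := (volume : Measure R3)) (F := ℝ)
    (hu1.norm_rpow hk1) (hc.comp_left (g := fun z : ℂ => ‖z‖ ^ (k : ℝ)) (by
      simp only [norm_zero]; exact Real.zero_rpow hk0.ne'))
    (p := 6 / 5) (p' := 2) (by rw [← NNReal.coe_le_coe]; norm_num) (by simp)
    (by rw [finrank_R3]; norm_num)
  have e1 : eLpNorm (fun x => ‖u x‖ ^ (k : ℝ)) ((2 : ℝ≥0) : ℝ≥0∞) volume =
      eLpNorm u (ENNReal.ofReal (2 * k)) volume ^ (k : ℝ) := by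
    rw [eLpNorm_norm_rpow _ hk0, ENNReal.ofReal_mul (by norm_num)]
    norm_num
  have e2 : eLpNorm (fderiv ℝ fun x => ‖u x‖ ^ (k : ℝ)) ((6 / 5 : ℝ≥0) : ℝ≥0∞) volume ≤
      k * (eLpNorm u (ENNReal.ofReal β) volume ^ ((k : ℝ) - 1) *
        eLpNorm (fderiv ℝ u) 6 volume) := by
    have e3 := eLpNorm_nnreal_pow_eq_lintegral (μ := volume)
      (f := fderiv ℝ fun x => ‖u x‖ ^ (k : ℝ)) (p := 6 / 5) (by norm_num)
    have h65 : ((6 / 5 : ℝ≥0) : ℝ) = 6 / 5 := by norm_num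
    rw [h65] at e3
    rw [← ENNReal.rpow_le_rpow_iff (z := 6 / 5) (by norm_num), e3]
    calc ∫⁻ x, ‖fderiv ℝ (fun x => ‖u x‖ ^ (k : ℝ)) x‖ₑ ^ (6 / 5 : ℝ)
        ≤ ∫⁻ x, (k : ℝ≥0∞) ^ (6 / 5 : ℝ) * (‖u x‖ₑ ^ (((k : ℝ) - 1) * (6 / 5)) *
            ‖fderiv ℝ u x‖ₑ ^ (6 / 5 : ℝ)) := by
          refine lintegral_mono fun x => ?_
          refine (ENNReal.rpow_le_rpow (enorm_fderiv_norm_rpow_le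
            (hu1.differentiable one_ne_zero) (by exact_mod_cast hk1)) (by norm_num)).trans
              (le_of_eq ?_)
          rw [ENNReal.mul_rpow_of_nonneg _ _ (by norm_num),
            ENNReal.mul_rpow_of_nonneg _ _ (by norm_num), ← ENNReal.rpow_mul, mul_assoc]
      _ = (k : ℝ≥0∞) ^ (6 / 5 : ℝ) * ∫⁻ x, (‖u x‖ₑ ^ (((k : ℝ) - 1) * (6 / 5)) *
            ‖fderiv ℝ u x‖ₑ ^ (6 / 5 : ℝ)) :=
          lintegral_const_mul' _ _ (ENNReal.rpow_ne_top_of_nonneg (by norm_num)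
            ENNReal.coe_ne_top)
      _ ≤ (k : ℝ≥0∞) ^ (6 / 5 : ℝ) * (eLpNorm u (ENNReal.ofReal β) volume ^
            (((k : ℝ) - 1) * (6 / 5)) *
              eLpNorm (fderiv ℝ u) (ENNReal.ofReal 6) volume ^ (6 / 5 : ℝ)) := by
          gcongr
          refine lintegral_enorm_rpow_mul_le hu.continuous.aestronglyMeasurable
            (hu1.continuous_fderiv one_ne_zero).aestronglyMeasurable hβ (by norm_num)
            (mul_nonneg (by linarith) (by norm_num)) (by norm_num) ?_
          rw [hk]; field_simp; ring
      _ = _ := by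
          rw [ENNReal.mul_rpow_of_nonneg _ _ (by norm_num),
            ENNReal.mul_rpow_of_nonneg _ _ (by norm_num), ← ENNReal.rpow_mul,
            ENNReal.ofReal_ofNat]
  rw [e1] at h
  refine h.trans ?_
  calc _ ≤ SNormLESNormFDerivOfEqConst ℝ (volume : Measure R3) (6 / 5 : ℝ≥0) *
        (k * (eLpNorm u (ENNReal.ofReal β) volume ^ ((k : ℝ) - 1) * (C₁ * hessianNorm u))) := by
        refine mul_le_mul_right (e2.trans ?_) _
        gcongr
        exact hC₁ u hu hc
    _ = _ := by push_cast; ring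

theorem exists_eLpNorm_le_rpow_mul_rpow_of_contDiff {a β k s : ℝ} (hβ : 4 ≤ β) (ha : 0 < a)
    (haβ : 1 / a = 1 / 2 + 2 / β) (hk : k = 1 + 2 * β / 3) (hs : s = (k - 1) / (2 * k)) :
    ∃ C : ℝ≥0, ∀ u : R3 → ℂ, ContDiff ℝ 2 u → HasCompactSupport u →
      eLpNorm u (ENNReal.ofReal (2 * k)) volume ≤
        C * eLpNorm (coordDeriv 2 u) (ENNReal.ofReal a) volume ^ s *
          hessianNorm u ^ (1 - s) := by
  obtain ⟨C₁, hC₁⟩ := exists_eLpNorm_le_coordDeriv_mul_hessianNorm hβ ha haβ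
  obtain ⟨C₂, hC₂⟩ := exists_eLpNorm_rpow_le_mul_hessianNorm (by linarith : 0 < β) hk
  have hk1 : 1 < k := by rw [hk]; linarith
  have hk0 : 0 < k := by linarith
  refine ⟨(C₂ * C₁ ^ (k - 1)) ^ (1 / k), fun u hu hc => ?_⟩
  set A := eLpNorm (coordDeriv 2 u) (ENNReal.ofReal a) volume with hA
  set H := hessianNorm u with hH
  have h1 := hC₁ u hu hc
  have h2 := hC₂ u hu hc
  have h3 : eLpNorm u (ENNReal.ofReal (2 * k)) volume ^ k ≤
      C₂ * ((C₁ * (A * H) ^ (1 / 2 : ℝ)) ^ (k - 1) * H) := by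
    refine h2.trans ?_
    gcongr
  have hks : 0 ≤ k - 1 := by linarith
  have hk' : 0 ≤ 1 / k := by positivity
  calc eLpNorm u (ENNReal.ofReal (2 * k)) volume
      = (eLpNorm u (ENNReal.ofReal (2 * k)) volume ^ k) ^ (1 / k) := by
        rw [← ENNReal.rpow_mul, mul_one_div_cancel hk0.ne', ENNReal.rpow_one]
    _ ≤ (C₂ * ((C₁ * (A * H) ^ (1 / 2 : ℝ)) ^ (k - 1) * H)) ^ (1 / k) :=
        ENNReal.rpow_le_rpow h3 hk'
    _ = _ := by
        rw [ENNReal.coe_rpow_of_nonneg _ hk', ENNReal.coe_mul, ENNReal.coe_rpow_of_nonneg _ hks]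
        -- `H` enters with power `(k-1)/(2k) = s` through the `L^β` bound and with power `1/k`
        -- directly; together these make `1 - s`.
        have e1 : H ^ (1 - s) = H ^ s * H ^ (1 / k) := by
          have hs0 : 0 ≤ s := by rw [hs]; positivity
          rw [← ENNReal.rpow_add_of_nonneg _ _ hs0 hk']
          congr 1
          rw [hs]; field_simp; ring
        have e2 : s = 1 / 2 * (k - 1) * (1 / k) := by rw [hs]; field_simp
        rw [e1]
        simp only [ENNReal.mul_rpow_of_nonneg _ _ hk', ENNReal.mul_rpow_of_nonneg _ _ hks,
          ENNReal.mul_rpow_of_nonneg _ _ (by norm_num : (0 : ℝ) ≤ 1 / 2), ← ENNReal.rpow_mul,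
          ← e2]
        ring

/-- Used only to show that a vanishing Hessian forces `f = 0`: it involves no `∂₃u` norm that could
be infinite. It is Sobolev for `u` followed by the interpolation with `p = b = 2`; the factor 6 is
three directions times 2. -/
theorem exists_eLpNorm_six_le_of_contDiff :
    ∃ C : ℝ≥0, ∀ u : R3 → ℂ, ContDiff ℝ 2 u → HasCompactSupport u →
      eLpNorm u 6 volume ≤ C * (eLpNorm u 2 volume * hessianNorm u) ^ (1 / 2 : ℝ) := by
  refine ⟨SNormLESNormFDerivOfEqConst ℂ (volume : Measure R3) (2 : ℝ≥0) * 6, fun u hu hc => ?_⟩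
  have hu1 : ContDiff ℝ 1 u := hu.of_le (by norm_num)
  have h := eLpNorm_le_eLpNorm_fderiv_of_eq (μ := (volume : Measure R3)) (F := ℂ) hu1
    hc (p := 2) (p' := 6) (by norm_num) (by simp) (by rw [finrank_R3]; norm_num)
  refine h.trans ?_
  rw [ENNReal.coe_mul, mul_assoc]
  gcongr
  rw [ENNReal.coe_ofNat]
  refine (eLpNorm_fderiv_le_sum hu1 (by norm_num)).trans ?_
  calc ∑ i, eLpNorm (coordDeriv i u) 2 volume
      ≤ ∑ i : Fin 3, 2 * (eLpNorm u 2 volume * hessianNorm u) ^ (1 / 2 : ℝ) := by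
        refine Finset.sum_le_sum fun i _ => ?_
        have h2 := eLpNorm_coordDeriv_le hu hc (p := 2) (b := 2) le_rfl two_pos (by norm_num) i
        norm_num at h2 ⊢
        refine h2.trans ?_
        gcongr
        exact eLpNorm_coordDeriv_coordDeriv_le_hessianNorm u i i
    _ = _ := by
        simp only [Finset.sum_const, Finset.card_univ, Fintype.card_fin, nsmul_eq_mul]
        rw [← mul_assoc]; norm_num

end Smooth

open scoped ContDiff Convolution

/-! ### Mollification: derivatives, norms and pointwise convergence -/

section Mollification

/-- The convolution of `g` with the kernel `φ`. -/
noncomputable def mollify (φ : R3 → ℝ) (g : R3 → ℂ) (x : R3) : ℂ :=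
  ∫ y, φ (x - y) • g y

theorem mollify_eq_convolution (φ : R3 → ℝ) (g : R3 → ℂ) :
    mollify φ g = g ⋆[(ContinuousLinearMap.lsmul ℝ ℝ).flip, volume] φ := rfl

theorem contDiff_mollify {φ : R3 → ℝ} (hφ : ContDiff ℝ ∞ φ) (hc : HasCompactSupport φ)
    {g : R3 → ℂ} (hg : LocallyIntegrable g) : ContDiff ℝ ∞ (mollify φ g) := by
  rw [mollify_eq_convolution]
  exact hc.contDiff_convolution_right _ hg hφ

theorem coordDeriv_mollify {φ : R3 → ℝ} (hφ : ContDiff ℝ ∞ φ) (hc : HasCompactSupport φ)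
    {g : R3 → ℂ} (hg : LocallyIntegrable g) (i : Fin 3) :
    coordDeriv i (mollify φ g) = mollify (coordDeriv i φ) g := by
  have hφ1 : ContDiff ℝ 1 φ := hφ.of_le (by norm_cast)
  ext x
  rw [mollify_eq_convolution, coordDeriv, (hc.hasFDerivAt_convolution_right _ hg hφ1 x).fderiv,
    convolution_precompR_apply _ hg (hc.fderiv ℝ) (hφ1.continuous_fderiv one_ne_zero)]
  rfl

/-- The weak derivative commutes with mollification. -/
theorem mollify_coordDeriv_eq {φ : R3 → ℝ} (hφ : ContDiff ℝ ∞ φ) (hc : HasCompactSupport φ)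
    {g h : Lp ℂ 2 (volume : Measure R3)} {i : Fin 3}
    (hgh : (h : 𝓢'(R3, ℂ)) = ∂_{stdBasis i} (g : 𝓢'(R3, ℂ))) :
    mollify (coordDeriv i φ) g = mollify φ h := by
  have hφ1 : ContDiff ℝ 1 φ := hφ.of_le (by norm_cast)
  ext x
  -- The distributional identity is tested against `y ↦ φ (x - y)`; the reflection produces a sign
  -- that cancels the one in the definition of the distributional derivative.
  have hsub : ContDiff ℝ ∞ fun y : R3 => x - y := contDiff_const.sub contDiff_id
  have hψ : ContDiff ℝ ∞ fun y : R3 => (φ (x - y) : ℂ) :=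
    Complex.ofRealCLM.contDiff.comp (hφ.comp hsub)
  have hψc : HasCompactSupport fun y : R3 => (φ (x - y) : ℂ) :=
    (hc.comp_homeomorph (Homeomorph.subLeft x)).comp_left Complex.ofReal_zero
  set ψ : 𝓢(R3, ℂ) := hψc.toSchwartzMap hψ with hψdef
  have hψx : ∀ y, ψ y = (φ (x - y) : ℂ) := fun y => rfl
  have hder : ∀ y, (-∂_{stdBasis i} ψ) y = ((coordDeriv i φ (x - y) : ℝ) : ℂ) := by
    intro y
    have h1 : HasFDerivAt (fun y : R3 => (φ (x - y) : ℂ))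
        (Complex.ofRealCLM.comp ((fderiv ℝ φ (x - y)).comp
          (-ContinuousLinearMap.id ℝ R3))) y :=
      Complex.ofRealCLM.hasFDerivAt.comp y
        ((hφ1.differentiable one_ne_zero (x - y)).hasFDerivAt.comp y
          ((hasFDerivAt_id y).const_sub x))
    have h2 : ∂_{stdBasis i} ψ y = -((coordDeriv i φ (x - y) : ℝ) : ℂ) := by
      rw [SchwartzMap.lineDerivOp_apply_eq_fderiv]
      have : fderiv ℝ ψ y = _ := h1.fderiv
      rw [this]
      simp [coordDeriv]
    rw [neg_apply, h2, neg_neg]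
  have key := congrArg (fun T : 𝓢'(R3, ℂ) => T ψ) hgh
  simp only [lineDerivOp_apply_apply, Lp.toTemperedDistribution_apply, hder, hψx] at key
  simp only [mollify, ← Complex.coe_smul]
  exact key.symm

/-- Jensen's inequality for a sub-probability density, obtained from Hölder with the splitting `w h
= (w h^a)^{1/a} w^{1-1/a}`. -/
theorem lintegral_mul_rpow_le {α : Type*} [MeasurableSpace α] {μ : Measure α} {w h : α → ℝ≥0∞}
    (hw : Measurable w) (hh : Measurable h) (hw1 : ∫⁻ x, w x ∂μ ≤ 1)
    {a : ℝ} (ha : 1 ≤ a) : (∫⁻ x, w x * h x ∂μ) ^ a ≤ ∫⁻ x, w x * h x ^ a ∂μ := by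
  have ha0 : 0 < a := by linarith
  have ha1 : 0 ≤ 1 - 1 / a := by
    rw [sub_nonneg, div_le_one ha0]; exact ha
  have h1 := ENNReal.lintegral_mul_norm_pow_le (μ := μ) (hw.mul (hh.pow_const a)).aemeasurable
    hw.aemeasurable (by positivity : 0 ≤ 1 / a) ha1 (by ring)
  have h2 : ∀ x, (w x * h x ^ a) ^ (1 / a) * w x ^ (1 - 1 / a) = w x * h x := by
    intro x
    rw [ENNReal.mul_rpow_of_nonneg _ _ (by positivity), ← ENNReal.rpow_mul,
      mul_one_div_cancel ha0.ne', ENNReal.rpow_one, mul_right_comm,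
      ← ENNReal.rpow_add_of_nonneg _ _ (by positivity) ha1]
    simp
  simp only [Pi.mul_apply, h2] at h1
  calc (∫⁻ x, w x * h x ∂μ) ^ a
      ≤ ((∫⁻ x, w x * h x ^ a ∂μ) ^ (1 / a) * 1) ^ a := by
        gcongr
        refine h1.trans ?_
        gcongr
        exact ENNReal.rpow_le_one hw1 ha1
    _ = _ := by
        rw [mul_one, ← ENNReal.rpow_mul, one_div_mul_cancel ha0.ne', ENNReal.rpow_one]

/-- Mollification with a probability density does not increase `Lᵃ` norms. -/
theorem eLpNorm_mollify_le {φ : R3 → ℝ} (hφ : Continuous φ) (hφ1 : ∫⁻ x, ‖φ x‖ₑ ≤ 1)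
    {g : R3 → ℂ} (hg : StronglyMeasurable g) {a : ℝ} (ha : 1 ≤ a) :
    eLpNorm (mollify φ g) (ENNReal.ofReal a) volume ≤
      eLpNorm g (ENNReal.ofReal a) volume := by
  have ha0 : 0 < a := by linarith
  have hφm : Measurable fun x => ‖φ x‖ₑ := hφ.enorm.measurable
  have hgm : Measurable fun x => ‖g x‖ₑ := hg.enorm
  rw [← ENNReal.rpow_le_rpow_iff ha0, ← lintegral_enorm_rpow_eq _ ha0,
    ← lintegral_enorm_rpow_eq _ ha0]
  calc ∫⁻ x, ‖mollify φ g x‖ₑ ^ a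
      ≤ ∫⁻ x, ∫⁻ y, ‖φ (x - y)‖ₑ * ‖g y‖ₑ ^ a := by
        -- Jensen's inequality at fixed `x`, with the translated kernel as density; Tonelli then
        -- integrates out `x`.
        refine lintegral_mono fun x => ?_
        have h1 : ∫⁻ y, ‖φ (x - y)‖ₑ ≤ 1 := by
          rwa [lintegral_sub_left_eq_self (fun y => ‖φ y‖ₑ) x]
        refine le_trans ?_ (lintegral_mul_rpow_le (hφm.comp (measurable_const.sub measurable_id))
          hgm h1 ha)
        gcongr
        refine (enorm_integral_le_lintegral_enorm _).trans (le_of_eq ?_)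
        exact lintegral_congr fun y => by rw [enorm_smul]; rfl
    _ = ∫⁻ y, ∫⁻ x, ‖φ (x - y)‖ₑ * ‖g y‖ₑ ^ a := by
        refine lintegral_lintegral_swap ?_
        exact ((hφm.comp (measurable_fst.sub measurable_snd)).mul
          ((hgm.comp measurable_snd).pow_const a)).aemeasurable
    _ = ∫⁻ y, (∫⁻ x, ‖φ x‖ₑ) * ‖g y‖ₑ ^ a := by
        refine lintegral_congr fun y => ?_
        have hm : Measurable fun x => ‖φ (x - y)‖ₑ :=
          hφm.comp (measurable_id.sub measurable_const)
        rw [lintegral_mul_const _ hm, lintegral_sub_right_eq_self (fun x => ‖φ x‖ₑ) y]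
    _ ≤ ∫⁻ y, ‖g y‖ₑ ^ a := by
        refine lintegral_mono fun y => ?_
        calc _ ≤ 1 * ‖g y‖ₑ ^ a := by gcongr
          _ = _ := one_mul _

/-- A sequence of smooth mollifiers, shrinking to the origin. -/
noncomputable def mollifierBump (n : ℕ) : ContDiffBump (0 : R3) where
  rIn := 1 / (n + 1)
  rOut := 2 / (n + 1)
  rIn_pos := by positivity
  rIn_lt_rOut := by gcongr; norm_num

/-- The kernel of the `n`-th mollifier. -/
noncomputable def mollifier (n : ℕ) : R3 → ℝ := (mollifierBump n).normed volume

theorem contDiff_mollifier (n : ℕ) : ContDiff ℝ ∞ (mollifier n) :=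
  (mollifierBump n).contDiff_normed

theorem hasCompactSupport_mollifier (n : ℕ) : HasCompactSupport (mollifier n) :=
  (mollifierBump n).hasCompactSupport_normed

theorem lintegral_mollifier (n : ℕ) : ∫⁻ x, ‖mollifier n x‖ₑ ≤ 1 := by
  have h1 := ofReal_integral_eq_lintegral_ofReal
    ((mollifierBump n).integrable_normed (μ := (volume : Measure R3)))
    (Eventually.of_forall (mollifierBump n).nonneg_normed)
  rw [(mollifierBump n).integral_normed, ENNReal.ofReal_one] at h1
  rw [h1]
  refine le_of_eq (lintegral_congr fun x => ?_)
  exact Real.enorm_of_nonneg ((mollifierBump n).nonneg_normed x)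

theorem ae_tendsto_mollify_mollifier {g : R3 → ℂ} (hg : LocallyIntegrable g) :
    ∀ᵐ x, Tendsto (fun n => mollify (mollifier n) g x) atTop (𝓝 (g x)) := by
  have hlim : Tendsto (fun n => (mollifierBump n).rOut) atTop (𝓝 0) := by
    have : Tendsto (fun n : ℕ => 2 * (1 / ((n : ℝ) + 1))) atTop (𝓝 (2 * 0)) :=
      tendsto_one_div_add_atTop_nhds_zero_nat.const_mul 2
    simpa [mollifierBump, div_eq_mul_inv] using this
  -- Lebesgue differentiation needs the ratio of outer to inner radius bounded along the sequence;
  -- here it is always 2.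
  have h := ContDiffBump.ae_convolution_tendsto_right_of_locallyIntegrable (μ := volume)
    (φ := mollifierBump) (K := 2) hlim
    (Eventually.of_forall fun n => le_of_eq (by simp [mollifierBump, div_eq_mul_inv])) hg
  filter_upwards [h] with x hx
  refine hx.congr fun n => ?_
  rw [convolution_lsmul_swap]
  rfl

end Mollification

/-! ### Anisotropic cutoffs -/

section Cutoff

/-- The diagonal linear map of `ℝ³` with the entries `d`. -/
noncomputable def diagScale (d : Fin 3 → ℝ) : R3 →ₗ[ℝ] R3 :=
  Matrix.toEuclideanLin (Matrix.diagonal d)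

theorem diagScale_apply (d : Fin 3 → ℝ) (x : R3) (i : Fin 3) :
    diagScale d x i = d i * x i := by
  simp [diagScale, Matrix.toLpLin_apply, Matrix.mulVec_diagonal]

theorem diagScale_stdBasis (d : Fin 3 → ℝ) (i : Fin 3) :
    diagScale d (stdBasis i) = d i • stdBasis i := by
  ext j
  rw [diagScale_apply]
  by_cases h : j = i <;> simp [stdBasis, h]

theorem det_diagScale (d : Fin 3 → ℝ) : LinearMap.det (diagScale d) = ∏ i, d i := by
  rw [diagScale, Matrix.toEuclideanLin_eq_toLin_orthonormal, LinearMap.det_toLin,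
    Matrix.det_diagonal]

theorem hasCompactSupport_comp_diagScale {F : Type*} [NormedAddCommGroup F] {u : R3 → F}
    (hu : HasCompactSupport u) {d : Fin 3 → ℝ} (hd : ∀ i, d i ≠ 0) :
    HasCompactSupport (fun x => u (diagScale d x)) := by
  refine hu.comp_isClosedEmbedding (g := diagScale d) ?_
  refine LinearMap.isClosedEmbedding_of_injective (LinearMap.ker_eq_bot.2 fun x y hxy => ?_)
  ext i
  have := congrArg (fun z : R3 => z i) hxy
  simpa [diagScale_apply, hd i] using this

theorem contDiff_comp_diagScale {F : Type*} [NormedAddCommGroup F] [NormedSpace ℝ F]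
    {u : R3 → F} {n : WithTop ℕ∞} (hu : ContDiff ℝ n u) (d : Fin 3 → ℝ) :
    ContDiff ℝ n (fun x => u (diagScale d x)) :=
  hu.comp (LinearMap.toContinuousLinearMap (diagScale d)).contDiff

theorem coordDeriv_comp_diagScale {u : R3 → ℝ} (hu : Differentiable ℝ u) (d : Fin 3 → ℝ)
    (i : Fin 3) :
    coordDeriv i (fun x => u (diagScale d x)) = fun x => d i * coordDeriv i u (diagScale d x) := by
  ext x
  have h := ((hu (diagScale d x)).hasFDerivAt.comp x
    (LinearMap.toContinuousLinearMap (diagScale d)).hasFDerivAt).fderiv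
  have h' : fderiv ℝ (fun x => u (diagScale d x)) x = _ := h
  rw [coordDeriv, h']
  simp [diagScale_stdBasis, coordDeriv]

theorem eLpNorm_comp_diagScale {u : R3 → ℝ} (hu : Continuous u) {d : Fin 3 → ℝ}
    (hd : ∀ i, 0 < d i) {q : ℝ} (hq : 0 < q) :
    eLpNorm (fun x => u (diagScale d x)) (ENNReal.ofReal q) volume =
      ENNReal.ofReal ((∏ i, d i) ^ (-(1 / q))) * eLpNorm u (ENNReal.ofReal q) volume := by
  have hprod : 0 < ∏ i, d i := Finset.prod_pos fun i _ => hd i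
  have hmap := Measure.map_linearMap_addHaar_eq_smul_addHaar (volume : Measure R3)
    (f := diagScale d) (by rw [det_diagScale]; exact hprod.ne')
  have hmeas : Measurable (diagScale d) :=
    (LinearMap.toContinuousLinearMap (diagScale d)).continuous.measurable
  have h1 := eLpNorm_map_measure (p := ENNReal.ofReal q) (f := diagScale d) (g := u)
    (μ := (volume : Measure R3)) hu.aestronglyMeasurable hmeas.aemeasurable
  rw [hmap, eLpNorm_smul_measure_of_ne_top (by simp), det_diagScale] at h1
  rw [show (fun x => u (diagScale d x)) = u ∘ diagScale d from rfl, ← h1, smul_eq_mul,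
    ENNReal.toReal_div, ENNReal.toReal_one, ENNReal.toReal_ofReal hq.le, abs_of_pos (inv_pos.2 hprod),
    ENNReal.ofReal_rpow_of_pos (inv_pos.2 hprod), Real.inv_rpow hprod.le,
    Real.rpow_neg hprod.le]

variable {χ : R3 → ℝ} {g : R3 → ℂ}

theorem coordDeriv_smul (hχ : Differentiable ℝ χ) (hg : Differentiable ℝ g) (i : Fin 3) :
    coordDeriv i (χ • g) =
      coordDeriv i χ • g + χ • coordDeriv i g := by
  ext x
  have h := ((hχ x).hasFDerivAt.smul (hg x).hasFDerivAt).fderiv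
  have h' : fderiv ℝ (χ • g) x = _ := h
  rw [coordDeriv, h']
  simp [coordDeriv, add_comm]

theorem coordDeriv_add {g h : R3 → ℂ} (hg : Differentiable ℝ g) (hh : Differentiable ℝ h)
    (i : Fin 3) : coordDeriv i (g + h) = coordDeriv i g + coordDeriv i h := by
  ext x
  rw [coordDeriv, fderiv_add (hg x) (hh x)]
  rfl

theorem eLpNorm_smul_le_of_bound (g : R3 → ℂ) {c : ℝ} (hχ : ∀ x, |χ x| ≤ c)
    (p : ℝ≥0∞) :
    eLpNorm (χ • g) p volume ≤ ENNReal.ofReal c * eLpNorm g p volume := by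
  refine eLpNorm_le_mul_eLpNorm_of_ae_le_mul (Eventually.of_forall fun x => ?_) p
  rw [Pi.smul_apply', norm_smul]
  gcongr
  exact hχ x

/-- Meant for the Leibniz term in which the cutoff is differentiated: the other factor is controlled
only in `L²`, so the derivative of the cutoff must be measured in `L^q`. -/
theorem eLpNorm_smul_le_eLpNorm_mul (hχ : Continuous χ) (hg : Continuous g) {a q : ℝ}
    (ha : 0 < a) (hq : 0 < q) (haq : 1 / a = 1 / q + 1 / 2) :
    eLpNorm (χ • g) (ENNReal.ofReal a) volume ≤
      eLpNorm χ (ENNReal.ofReal q) volume * eLpNorm g 2 volume := by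
  rw [← ENNReal.rpow_le_rpow_iff ha, ← lintegral_enorm_rpow_eq _ ha,
    ENNReal.mul_rpow_of_nonneg _ _ ha.le]
  have h := lintegral_enorm_rpow_mul_le (μ := volume) hχ.aestronglyMeasurable
    hg.aestronglyMeasurable hq two_pos ha.le ha.le (by
      have : a * (1 / a) = 1 := mul_one_div_cancel ha.ne'
      rw [haq] at this
      linear_combination this)
  rw [ENNReal.ofReal_ofNat] at h
  refine le_trans (le_of_eq (lintegral_congr fun x => ?_)) h
  rw [Pi.smul_apply', enorm_smul, ENNReal.mul_rpow_of_nonneg _ _ ha.le]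

theorem eLpNorm_coordDeriv_smul_le (hχ : ContDiff ℝ 2 χ) (hg : ContDiff ℝ 2 g)
    (hχ1 : ∀ x, |χ x| ≤ 1) {a q : ℝ} (ha : 1 ≤ a) (hq : 0 < q)
    (haq : 1 / a = 1 / q + 1 / 2) (i : Fin 3) :
    eLpNorm (coordDeriv i (χ • g)) (ENNReal.ofReal a) volume ≤
      eLpNorm (coordDeriv i g) (ENNReal.ofReal a) volume +
        eLpNorm (coordDeriv i χ) (ENNReal.ofReal q) volume * eLpNorm g 2 volume := by
  have hχ' : ContDiff ℝ 1 χ := hχ.of_le (by norm_num)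
  have hg' : ContDiff ℝ 1 g := hg.of_le (by norm_num)
  have hc1 := continuous_coordDeriv hχ' i
  have hc2 := continuous_coordDeriv hg' i
  rw [coordDeriv_smul (hχ.differentiable two_ne_zero) (hg.differentiable two_ne_zero), add_comm]
  refine (eLpNorm_add_le (hχ.continuous.smul hc2).aestronglyMeasurable
    (hc1.smul hg.continuous).aestronglyMeasurable (by rwa [ENNReal.one_le_ofReal])).trans ?_
  gcongr
  · simpa using eLpNorm_smul_le_of_bound (coordDeriv i g) hχ1 (ENNReal.ofReal a)
  · exact eLpNorm_smul_le_eLpNorm_mul hc1 hg.continuous (by linarith) hq haq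

/-- In the Leibniz expansion every term except `χ ∂ᵢ∂ⱼg` carries a derivative of `χ`, hence the
factor `c`, which will tend to 0. -/
theorem eLpNorm_coordDeriv_coordDeriv_smul_le (hχ : ContDiff ℝ 2 χ) (hg : ContDiff ℝ 2 g)
    {c : ℝ} (hχ1 : ∀ x, |χ x| ≤ 1) (hχ2 : ∀ i x, |coordDeriv i χ x| ≤ c)
    (hχ3 : ∀ i j x, |coordDeriv i (coordDeriv j χ) x| ≤ c) (i j : Fin 3) :
    eLpNorm (coordDeriv i (coordDeriv j (χ • g))) 2 volume ≤
      eLpNorm (coordDeriv i (coordDeriv j g)) 2 volume + ENNReal.ofReal c *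
        (eLpNorm g 2 volume + eLpNorm (coordDeriv i g) 2 volume +
          eLpNorm (coordDeriv j g) 2 volume) := by
  have hχ' : ContDiff ℝ 1 χ := hχ.of_le (by norm_num)
  have hg' : ContDiff ℝ 1 g := hg.of_le (by norm_num)
  have hχj := contDiff_coordDeriv hχ j
  have hgj := contDiff_coordDeriv hg j
  have dχ := hχ.differentiable two_ne_zero
  have dg := hg.differentiable two_ne_zero
  have dχj := hχj.differentiable one_ne_zero
  have dgj := hgj.differentiable one_ne_zero
  rw [coordDeriv_smul dχ dg, coordDeriv_add (dχj.smul dg) (dχ.smul dgj),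
    coordDeriv_smul dχj dg, coordDeriv_smul dχ dgj]
  have m1 := ((continuous_coordDeriv hχj i).smul hg.continuous).aestronglyMeasurable (μ := volume)
  have m2 := (hχj.continuous.smul (continuous_coordDeriv hg' i)).aestronglyMeasurable
    (μ := volume)
  have m3 := ((continuous_coordDeriv hχ' i).smul hgj.continuous).aestronglyMeasurable
    (μ := volume)
  have m4 := (hχ.continuous.smul (continuous_coordDeriv hgj i)).aestronglyMeasurable
    (μ := volume)
  have hp : (1 : ℝ≥0∞) ≤ 2 := by norm_num
  refine (eLpNorm_add_le (m1.add m2) (m3.add m4) hp).trans ?_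
  refine (add_le_add (eLpNorm_add_le m1 m2 hp) (eLpNorm_add_le m3 m4 hp)).trans ?_
  have b1 := eLpNorm_smul_le_of_bound g (hχ3 i j) 2
  have b2 := eLpNorm_smul_le_of_bound (coordDeriv i g) (hχ2 j) 2
  have b3 := eLpNorm_smul_le_of_bound (coordDeriv j g) (hχ2 i) 2
  have b4 := eLpNorm_smul_le_of_bound (coordDeriv i (coordDeriv j g)) hχ1 2
  rw [ENNReal.ofReal_one, one_mul] at b4
  refine (add_le_add (add_le_add b1 b2) (add_le_add b3 b4)).trans (le_of_eq ?_)
  ring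

/-- A smooth bump on `ℝ³`, equal to `1` on the unit ball. -/
noncomputable def baseBump : ContDiffBump (0 : R3) where
  rIn := 1
  rOut := 2
  rIn_pos := one_pos
  rIn_lt_rOut := by norm_num

/-- The anisotropic dilation factors of the cutoff functions. -/
noncomputable def cutoffScale (n : ℕ) : Fin 3 → ℝ :=
  -- With `δ = 1/(n+1)`, an isotropic cutoff would give `‖∂₃χ‖_q ~ δ^{1-3/q}`, which blows up for `q
  -- < 3`. The cube gives `δ^{3-5/q}`, which tends to 0 for all `q ≥ 2`.
  ![1 / (n + 1), 1 / (n + 1), (1 / (n + 1)) ^ 3]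

/-- Smooth cutoff functions, stretched more in the direction of the last coordinate. -/
noncomputable def cutoff (n : ℕ) (x : R3) : ℝ := baseBump (diagScale (cutoffScale n) x)

theorem one_div_succ_pos (n : ℕ) : (0 : ℝ) < 1 / (n + 1) := by positivity

theorem one_div_succ_le_one (n : ℕ) : (1 : ℝ) / (n + 1) ≤ 1 := by
  rw [div_le_one (by positivity)]; linarith [n.cast_nonneg (α := ℝ)]

theorem cutoffScale_pos (n : ℕ) (i : Fin 3) : 0 < cutoffScale n i := by
  fin_cases i <;> simp [cutoffScale] <;> positivity

theorem cutoffScale_le (n : ℕ) (i : Fin 3) : cutoffScale n i ≤ 1 / (n + 1) := by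
  have h0 := one_div_succ_pos n
  have h1 := one_div_succ_le_one n
  fin_cases i
  · exact le_rfl
  · exact le_rfl
  · exact pow_le_of_le_one h0.le h1 (by norm_num)

theorem contDiff_cutoff (n : ℕ) : ContDiff ℝ 2 (cutoff n) :=
  contDiff_comp_diagScale (baseBump.contDiff (n := (2 : ℕ∞))) _

theorem hasCompactSupport_cutoff (n : ℕ) : HasCompactSupport (cutoff n) :=
  hasCompactSupport_comp_diagScale baseBump.hasCompactSupport fun i => (cutoffScale_pos n i).ne'

theorem abs_cutoff_le_one (n : ℕ) (x : R3) : |cutoff n x| ≤ 1 := by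
  rw [cutoff, abs_of_nonneg baseBump.nonneg]
  exact baseBump.le_one

theorem tendsto_cutoff (x : R3) : Tendsto (fun n => cutoff n x) atTop (𝓝 1) := by
  have hδ : Tendsto (fun n : ℕ => (1 : ℝ) / (n + 1)) atTop (𝓝 0) :=
    tendsto_one_div_add_atTop_nhds_zero_nat
  have hd : ∀ i, Tendsto (fun n => cutoffScale n i) atTop (𝓝 0) := fun i =>
    squeeze_zero (fun n => (cutoffScale_pos n i).le) (fun n => cutoffScale_le n i) hδ
  have hL : Tendsto (fun n => diagScale (cutoffScale n) x) atTop (𝓝 0) := by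
    have h2 : Tendsto (fun n => WithLp.ofLp (diagScale (cutoffScale n) x)) atTop (𝓝 0) := by
      rw [tendsto_pi_nhds]
      intro i
      simp only [diagScale_apply]
      simpa using (hd i).mul_const (x i)
    exact ((PiLp.continuousLinearEquiv 2 ℝ (fun _ : Fin 3 => ℝ)).symm.continuous.tendsto 0).comp h2
  have h3 := (baseBump.continuous.tendsto (0 : R3)).comp hL
  rwa [baseBump.one_of_mem_closedBall (by simp [baseBump])] at h3

theorem coordDeriv_cutoff (n : ℕ) (i : Fin 3) :
    coordDeriv i (cutoff n) =
      fun x => cutoffScale n i * coordDeriv i baseBump (diagScale (cutoffScale n) x) :=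
  coordDeriv_comp_diagScale ((baseBump.contDiff (n := (2 : ℕ∞))).differentiable two_ne_zero) _ i

/-- Each derivative produces a scale factor at most `1/(n+1)`. For second derivatives one of the two
factors is merely bounded by 1, so that a single rate serves both orders. -/
theorem exists_coordDeriv_cutoff_bound : ∃ M : ℝ, 0 ≤ M ∧ ∀ n i,
    (∀ x, |coordDeriv i (cutoff n) x| ≤ M * (1 / (n + 1))) ∧
      ∀ j x, |coordDeriv i (coordDeriv j (cutoff n)) x| ≤ M * (1 / (n + 1)) := by
  have hb : ContDiff ℝ 2 (baseBump : R3 → ℝ) := baseBump.contDiff (n := (2 : ℕ∞))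
  have hb1 : ContDiff ℝ 1 (baseBump : R3 → ℝ) := hb.of_le (by norm_num)
  have hbc := baseBump.hasCompactSupport
  have h1 : ∀ i, ∃ C, ∀ x, ‖coordDeriv i baseBump x‖ ≤ C := fun i =>
    (continuous_coordDeriv hb1 i).bounded_above_of_compact_support
      (hasCompactSupport_coordDeriv hbc i)
  have h2 : ∀ i j, ∃ C, ∀ x, ‖coordDeriv i (coordDeriv j baseBump) x‖ ≤ C := fun i j =>
    (continuous_coordDeriv (contDiff_coordDeriv hb j) i).bounded_above_of_compact_support
      (hasCompactSupport_coordDeriv (hasCompactSupport_coordDeriv hbc j) i)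
  choose A hA using h1
  choose B hB using h2
  have hA0 : ∀ i, 0 ≤ A i := fun i => (norm_nonneg _).trans (hA i 0)
  have hB0 : ∀ i j, 0 ≤ B i j := fun i j => (norm_nonneg _).trans (hB i j 0)
  have hAs : ∀ i, A i ≤ ∑ i, A i := fun i =>
    Finset.single_le_sum (fun i _ => hA0 i) (Finset.mem_univ i)
  have hBs : ∀ i j, B i j ≤ ∑ i, ∑ j, B i j := fun i j =>
    (Finset.single_le_sum (f := fun j => B i j) (fun j _ => hB0 i j) (Finset.mem_univ j)).trans
      (Finset.single_le_sum (f := fun i => ∑ j, B i j)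
        (fun i _ => Finset.sum_nonneg fun j _ => hB0 i j) (Finset.mem_univ i))
  have hSA : 0 ≤ ∑ i, A i := Finset.sum_nonneg fun i _ => hA0 i
  have hSB : 0 ≤ ∑ i, ∑ j, B i j := Finset.sum_nonneg fun i _ => Finset.sum_nonneg fun j _ => hB0 i j
  refine ⟨(∑ i, A i) + ∑ i, ∑ j, B i j, by positivity, fun n i => ⟨fun x => ?_, fun j x => ?_⟩⟩
  · rw [coordDeriv_cutoff, abs_mul, abs_of_pos (cutoffScale_pos n i), mul_comm]
    refine mul_le_mul ?_ (cutoffScale_le n i) (cutoffScale_pos n i).le (by positivity)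
    exact (hA i _).trans (by linarith [hAs i])
  · have hd : Differentiable ℝ fun x => coordDeriv j baseBump (diagScale (cutoffScale n) x) :=
      (contDiff_comp_diagScale (contDiff_coordDeriv hb j) _).differentiable one_ne_zero
    have e : coordDeriv i (coordDeriv j (cutoff n)) = fun x => cutoffScale n j * (cutoffScale n i *
        coordDeriv i (coordDeriv j baseBump) (diagScale (cutoffScale n) x)) := by
      rw [coordDeriv_cutoff]
      have h := coordDeriv_clm_comp (cutoffScale n j • ContinuousLinearMap.id ℝ ℝ) hd i
      rw [coordDeriv_comp_diagScale ((contDiff_coordDeriv hb j).differentiable one_ne_zero)] at h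
      simpa using h
    rw [e, abs_mul, abs_mul, abs_of_pos (cutoffScale_pos n i), abs_of_pos (cutoffScale_pos n j)]
    have k1 : cutoffScale n j ≤ 1 := (cutoffScale_le n j).trans (one_div_succ_le_one n)
    calc _ ≤ 1 * ((1 / (n + 1)) * ((∑ i, A i) + ∑ i, ∑ j, B i j)) := by
          have := (cutoffScale_pos n i).le
          have := cutoffScale_le n i
          have h4 : |coordDeriv i (coordDeriv j baseBump) (diagScale (cutoffScale n) x)| ≤
            (∑ i, A i) + ∑ i, ∑ j, B i j := (hB i j _).trans (by linarith [hBs i j])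
          gcongr
      _ = _ := by ring

theorem tendsto_eLpNorm_coordDeriv_cutoff {q : ℝ} (hq : 2 ≤ q) :
    Tendsto (fun n => eLpNorm (coordDeriv 2 (cutoff n)) (ENNReal.ofReal q) volume) atTop
      (𝓝 0) := by
  have hq0 : 0 < q := by linarith
  have hb : ContDiff ℝ 1 (baseBump : R3 → ℝ) := baseBump.contDiff (n := (1 : ℕ∞))
  have hc := continuous_coordDeriv hb 2
  set N := eLpNorm (coordDeriv 2 baseBump) (ENNReal.ofReal q) volume with hN
  have hNt : N ≠ ⊤ := (hc.memLp_of_hasCompactSupport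
    (hasCompactSupport_coordDeriv baseBump.hasCompactSupport 2)).2.ne
  have hexp : 0 < 3 - 5 / q := by
    have : 5 / q ≤ 5 / 2 := by gcongr
    linarith
  have heq : ∀ n, eLpNorm (coordDeriv 2 (cutoff n)) (ENNReal.ofReal q) volume =
      ENNReal.ofReal ((1 / ((n : ℝ) + 1)) ^ (3 - 5 / q)) * N := by
    intro n
    have h0 := one_div_succ_pos n
    rw [coordDeriv_cutoff]
    have h1 := eLpNorm_const_smul (p := ENNReal.ofReal q) (μ := volume) (cutoffScale n 2)
      (fun x => coordDeriv 2 baseBump (diagScale (cutoffScale n) x))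
    have h2 : (cutoffScale n 2 • fun x => coordDeriv 2 baseBump (diagScale (cutoffScale n) x)) =
      fun x => cutoffScale n 2 * coordDeriv 2 baseBump (diagScale (cutoffScale n) x) := rfl
    rw [h2, eLpNorm_comp_diagScale hc (cutoffScale_pos n) hq0,
      Real.enorm_of_nonneg (cutoffScale_pos n 2).le, ← mul_assoc,
      ← ENNReal.ofReal_mul (cutoffScale_pos n 2).le] at h1
    rw [h1]
    congr 2
    have e1 : cutoffScale n 2 = (1 / ((n : ℝ) + 1)) ^ (3 : ℝ) := by
      rw [show (3 : ℝ) = ((3 : ℕ) : ℝ) by norm_num, Real.rpow_natCast]; rfl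
    -- The Jacobian of the dilation: `1 + 1 + 3 = 5`.
    have e2 : ∏ i, cutoffScale n i = (1 / ((n : ℝ) + 1)) ^ (5 : ℝ) := by
      rw [show (5 : ℝ) = ((5 : ℕ) : ℝ) by norm_num, Real.rpow_natCast, Fin.prod_univ_three]
      simp only [cutoffScale, Matrix.cons_val_zero, Matrix.cons_val_one, Matrix.cons_val]
      ring
    rw [e2, e1, ← Real.rpow_mul h0.le, ← Real.rpow_add h0]
    congr 1; ring
  simp only [heq]
  have hδ : Tendsto (fun n : ℕ => (1 : ℝ) / (n + 1)) atTop (𝓝 0) :=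
    tendsto_one_div_add_atTop_nhds_zero_nat
  have h3 : Tendsto (fun n : ℕ => ((1 : ℝ) / (n + 1)) ^ (3 - 5 / q)) atTop (𝓝 0) := by
    have := hδ.rpow_const (p := 3 - 5 / q) (Or.inr hexp.le)
    rwa [Real.zero_rpow hexp.ne'] at this
  have h4 := ENNReal.tendsto_ofReal h3
  rw [ENNReal.ofReal_zero] at h4
  simpa using ENNReal.Tendsto.mul_const h4 (Or.inr hNt)

end Cutoff

/-! ### Approximation in H² and functions with vanishing Hessian -/

section Approximation

theorem locallyIntegrable_coeFn (f : Lp ℂ 2 (volume : Measure R3)) :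
    LocallyIntegrable f :=
  (Lp.memLp f).locallyIntegrable (by norm_num)

theorem coordDeriv_mollify_mollifier {f : Lp ℂ 2 (volume : Measure R3)} (hf : MemH2 f) (n : ℕ)
    (i : Fin 3) :
    coordDeriv i (mollify (mollifier n) f) = mollify (mollifier n) (partialDeriv i f) := by
  rw [coordDeriv_mollify (contDiff_mollifier n) (hasCompactSupport_mollifier n)
    (locallyIntegrable_coeFn f), mollify_coordDeriv_eq (contDiff_mollifier n)
    (hasCompactSupport_mollifier n) (coe_partialDeriv hf i)]

theorem coordDeriv_coordDeriv_mollify_mollifier {f : Lp ℂ 2 (volume : Measure R3)} (hf : MemH2 f)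
    (n : ℕ) (i j : Fin 3) :
    coordDeriv i (coordDeriv j (mollify (mollifier n) f)) =
      mollify (mollifier n) (partialDeriv₂ i j f) := by
  have h : (partialDeriv₂ i j f : 𝓢'(R3, ℂ)) =
      ∂_{stdBasis i} (partialDeriv j f : 𝓢'(R3, ℂ)) := by
    rw [coe_partialDeriv₂ hf, coe_partialDeriv hf]
  rw [coordDeriv_mollify_mollifier hf, coordDeriv_mollify (contDiff_mollifier n)
    (hasCompactSupport_mollifier n) (locallyIntegrable_coeFn _),
    mollify_coordDeriv_eq (contDiff_mollifier n) (hasCompactSupport_mollifier n) h]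

theorem eLpNorm_mollify_mollifier_le (f : Lp ℂ 2 (volume : Measure R3)) (n : ℕ) {a : ℝ}
    (ha : 1 ≤ a) :
    eLpNorm (mollify (mollifier n) f) (ENNReal.ofReal a) volume ≤
      eLpNorm f (ENNReal.ofReal a) volume :=
  eLpNorm_mollify_le (contDiff_mollifier n).continuous (lintegral_mollifier n)
    (Lp.stronglyMeasurable f) ha

theorem eLpNorm_mollify_mollifier_two_le (f : Lp ℂ 2 (volume : Measure R3)) (n : ℕ) :
    eLpNorm (mollify (mollifier n) f) 2 volume ≤ eLpNorm f 2 volume := by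
  simpa using eLpNorm_mollify_mollifier_le f n one_le_two

/-- Functions in `H²(ℝ³)` are limits of compactly supported `C²` functions, with control of the
`Lᵃ` norm of one first derivative and of the `L²` norms of the second derivatives. -/
theorem MemH2.exists_approximation {f : Lp ℂ 2 (volume : Measure R3)} (hf : MemH2 f) {a : ℝ}
    (ha₁ : 1 ≤ a) (ha₂ : a < 2) :
    ∃ (u : ℕ → R3 → ℂ) (E : ℕ → ℝ≥0∞), Tendsto E atTop (𝓝 0) ∧
      (∀ n, ContDiff ℝ 2 (u n)) ∧ (∀ n, HasCompactSupport (u n)) ∧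
      (∀ᵐ x, Tendsto (fun n => u n x) atTop (𝓝 (f x))) ∧
      (∀ n, eLpNorm (u n) 2 volume ≤ eLpNorm f 2 volume) ∧
      (∀ n, eLpNorm (coordDeriv 2 (u n)) (ENNReal.ofReal a) volume ≤
        eLpNorm (partialDeriv 2 f) (ENNReal.ofReal a) volume + E n) ∧
      ∀ n i j, eLpNorm (coordDeriv i (coordDeriv j (u n))) 2 volume ≤
        eLpNorm (partialDeriv₂ i j f) 2 volume + E n := by
  obtain ⟨M, hM0, hM⟩ := exists_coordDeriv_cutoff_bound
  -- The Hölder partner of `L²` in `L^a`; `a ≥ 1` gives `q ≥ 2`, as the cutoffs require, and `a < 2`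
  -- makes `q` finite.
  obtain ⟨q, hq2, hq⟩ : ∃ q : ℝ, 2 ≤ q ∧ 1 / a = 1 / q + 1 / 2 := by
    have h1 : 1 / a ≤ 1 := by rw [div_le_one (by linarith)]; exact ha₁
    have h2 : 1 / 2 < 1 / a := one_div_lt_one_div_of_lt (by linarith) ha₂
    refine ⟨1 / (1 / a - 1 / 2), ?_, by rw [one_div_one_div]; ring⟩
    rw [le_div_iff₀ (by linarith)]
    linarith
  set g : ℕ → R3 → ℂ := fun n => mollify (mollifier n) f with hg
  have hgC : ∀ n, ContDiff ℝ 2 (g n) := fun n =>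
    (contDiff_mollify (contDiff_mollifier n) (hasCompactSupport_mollifier n)
      (locallyIntegrable_coeFn f)).of_le (by norm_cast)
  -- The two equal sums bound the norms of `∂ᵢf` and `∂ⱼf` in the Leibniz error, uniformly in `i`
  -- and `j`.
  set S : ℝ≥0∞ := eLpNorm f 2 volume + ∑ i, eLpNorm (partialDeriv i f) 2 volume +
    ∑ i, eLpNorm (partialDeriv i f) 2 volume with hS
  have hft : eLpNorm f 2 volume ≠ ⊤ := (Lp.memLp f).2.ne
  have hSs : (∑ i, eLpNorm (partialDeriv i f) 2 volume) ≠ ⊤ :=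
    ENNReal.sum_ne_top.2 fun i _ => (Lp.memLp _).2.ne
  have hSt : S ≠ ⊤ := ENNReal.add_ne_top.2 ⟨ENNReal.add_ne_top.2 ⟨hft, hSs⟩, hSs⟩
  set E₁ : ℕ → ℝ≥0∞ := fun n =>
    eLpNorm (coordDeriv 2 (cutoff n)) (ENNReal.ofReal q) volume * eLpNorm f 2 volume with hE₁
  set E₂ : ℕ → ℝ≥0∞ := fun n => ENNReal.ofReal (M * (1 / (n + 1))) * S with hE₂
  have hE₁t : Tendsto E₁ atTop (𝓝 0) := by
    simpa using ENNReal.Tendsto.mul_const (tendsto_eLpNorm_coordDeriv_cutoff hq2) (Or.inr hft)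
  have hE₂t : Tendsto E₂ atTop (𝓝 0) := by
    have h1 : Tendsto (fun n : ℕ => M * ((1 : ℝ) / (n + 1))) atTop (𝓝 (M * 0)) :=
      tendsto_one_div_add_atTop_nhds_zero_nat.const_mul M
    have h2 := ENNReal.tendsto_ofReal h1
    rw [mul_zero, ENNReal.ofReal_zero] at h2
    have h3 := ENNReal.Tendsto.mul_const h2 (Or.inr hSt)
    rwa [zero_mul] at h3
  refine ⟨fun n => cutoff n • g n, fun n => E₁ n + E₂ n, by simpa using hE₁t.add hE₂t,
    fun n => (contDiff_cutoff n).smul (hgC n), fun n => (hasCompactSupport_cutoff n).smul_right,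
    ?_, fun n => ?_, fun n => ?_, fun n i j => ?_⟩
  · filter_upwards [ae_tendsto_mollify_mollifier (locallyIntegrable_coeFn f)] with x hx
    simpa using (tendsto_cutoff x).smul hx
  · refine (eLpNorm_smul_le_of_bound (g n) (abs_cutoff_le_one n) 2).trans ?_
    rw [ENNReal.ofReal_one, one_mul]
    exact eLpNorm_mollify_mollifier_two_le f n
  · refine (eLpNorm_coordDeriv_smul_le (contDiff_cutoff n) (hgC n) (abs_cutoff_le_one n) ha₁
      (by linarith) hq 2).trans ?_
    rw [hg, coordDeriv_mollify_mollifier hf]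
    refine add_le_add (eLpNorm_mollify_mollifier_le _ n ha₁) (le_trans ?_ le_self_add)
    exact mul_le_mul_right (eLpNorm_mollify_mollifier_two_le f n) _
  · refine (eLpNorm_coordDeriv_coordDeriv_smul_le (contDiff_cutoff n) (hgC n)
      (abs_cutoff_le_one n) (fun i => (hM n i).1) (fun i j => (hM n i).2 j) i j).trans ?_
    rw [hg, coordDeriv_coordDeriv_mollify_mollifier hf, coordDeriv_mollify_mollifier hf,
      coordDeriv_mollify_mollifier hf]
    refine add_le_add (eLpNorm_mollify_mollifier_two_le _ n) (le_trans ?_ le_add_self)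
    have hi : ∀ i, eLpNorm (mollify (mollifier n) (partialDeriv i f)) 2 volume ≤
        ∑ i, eLpNorm (partialDeriv i f) 2 volume := fun i =>
      (eLpNorm_mollify_mollifier_two_le _ n).trans
        (Finset.single_le_sum (f := fun i => eLpNorm (partialDeriv i f) 2 volume)
          (by simp) (Finset.mem_univ i))
    exact mul_le_mul_right
      (add_le_add (add_le_add (eLpNorm_mollify_mollifier_two_le f n) (hi i)) (hi j)) _

theorem eLpNorm_partialDeriv₂_le_hessian (f : Lp ℂ 2 (volume : Measure R3)) (i j : Fin 3) :
    eLpNorm (partialDeriv₂ i j f) 2 volume ≤ eLpNorm (hessian f) 2 volume :=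
  eLpNorm_mono fun x => PiLp.norm_apply_le (hessian f x) (i, j)

/-- Holds for every `f`, since `partialDeriv₂` is an `L²` element by construction (0 by default). -/
theorem eLpNorm_hessian_ne_top (f : Lp ℂ 2 (volume : Measure R3)) :
    eLpNorm (hessian f) 2 volume ≠ ⊤ := by
  have h : eLpNorm (hessian f) 2 volume ≤
      eLpNorm (∑ ij : Fin 3 × Fin 3, fun x => ‖partialDeriv₂ ij.1 ij.2 f x‖) 2 volume := by
    refine eLpNorm_mono_real fun x => ?_
    rw [Finset.sum_apply]
    have hx : hessian f x = ∑ ij, EuclideanSpace.single ij (hessian f x ij) := by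
      ext ij; simp [Finset.sum_apply, Pi.single_apply]
    conv_lhs => rw [hx]
    refine (norm_sum_le _ _).trans (le_of_eq ?_)
    refine Finset.sum_congr rfl fun ij _ => ?_
    rw [PiLp.norm_single]
    rfl
  refine (h.trans_lt ((eLpNorm_sum_le (fun ij _ => (Lp.aestronglyMeasurable _).norm)
    (by norm_num)).trans_lt ?_)).ne
  refine ENNReal.sum_lt_top.2 fun ij _ => ?_
  rw [eLpNorm_norm]
  exact (Lp.memLp _).2

theorem hessianNorm_le_of_forall_le {u : R3 → ℂ} {K : ℝ≥0∞}
    (h : ∀ i j, eLpNorm (coordDeriv i (coordDeriv j u)) 2 volume ≤ K) :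
    hessianNorm u ≤ 9 * K := by
  calc hessianNorm u ≤ ∑ _j : Fin 3, ∑ _i : Fin 3, K :=
        Finset.sum_le_sum fun j _ => Finset.sum_le_sum fun i _ => h i j
    _ = 9 * K := by
        simp only [Finset.sum_const, Finset.card_univ, Fintype.card_fin, nsmul_eq_mul]
        rw [← mul_assoc]; norm_num

theorem tendsto_add_rpow {E : ℕ → ℝ≥0∞} (hE : Tendsto E atTop (𝓝 0)) (A : ℝ≥0∞) (s : ℝ) :
    Tendsto (fun n => (A + E n) ^ s) atTop (𝓝 (A ^ s)) := by
  have h := (ENNReal.continuous_rpow_const (y := s)).tendsto A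
  refine h.comp ?_
  simpa using tendsto_const_nhds.add hE

/-- A function in `H²(ℝ³)` with vanishing Hessian vanishes. -/
theorem MemH2.ae_eq_zero_of_hessian {f : Lp ℂ 2 (volume : Measure R3)} (hf : MemH2 f)
    (h : eLpNorm (hessian f) 2 volume = 0) : (f : R3 → ℂ) =ᵐ[volume] 0 := by
  -- The choice `a = 1` is immaterial: the bound on `∂₃` is discarded.
  obtain ⟨u, E, hE, hu, huc, hlim, hu2, -, huH⟩ := hf.exists_approximation le_rfl one_lt_two
  obtain ⟨C, hC⟩ := exists_eLpNorm_six_le_of_contDiff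
  have hft : eLpNorm f 2 volume ≠ ⊤ := (Lp.memLp f).2.ne
  have hle : ∀ n, eLpNorm (u n) 6 volume ≤
      C * (eLpNorm f 2 volume * (9 * (0 + E n))) ^ (1 / 2 : ℝ) := by
    intro n
    refine (hC (u n) (hu n) (huc n)).trans ?_
    gcongr
    · exact hu2 n
    · refine hessianNorm_le_of_forall_le fun i j => (huH n i j).trans ?_
      rw [← h]
      gcongr
      exact eLpNorm_partialDeriv₂_le_hessian f i j
  have hto : Tendsto (fun n => C * (eLpNorm f 2 volume * (9 * (0 + E n))) ^ (1 / 2 : ℝ)) atTop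
      (𝓝 0) := by
    have h1 : Tendsto (fun n => eLpNorm f 2 volume * (9 * (0 + E n))) atTop (𝓝 0) := by
      have h2 : Tendsto (fun n => 9 * (0 + E n)) atTop (𝓝 (9 * 0)) :=
        ENNReal.Tendsto.const_mul (by simpa using hE) (Or.inr (by norm_num))
      rw [mul_zero] at h2
      simpa using ENNReal.Tendsto.const_mul h2 (Or.inr hft)
    have h3 := ((ENNReal.continuous_rpow_const (y := 1 / 2)).tendsto 0).comp h1
    have h4 := ENNReal.Tendsto.const_mul (a := (C : ℝ≥0∞)) h3 (Or.inr ENNReal.coe_ne_top)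
    simpa using h4
  have h6 : eLpNorm f 6 volume ≤ 0 :=
    -- Fatou's lemma along the almost everywhere convergent approximations.
    calc eLpNorm f 6 volume ≤ liminf (fun n => eLpNorm (u n) 6 volume) atTop :=
          Lp.eLpNorm_lim_le_liminf_eLpNorm
            (fun n => (hu n).continuous.aestronglyMeasurable) _ hlim
      _ ≤ liminf (fun n => C * (eLpNorm f 2 volume * (9 * (0 + E n))) ^ (1 / 2 : ℝ)) atTop :=
          liminf_le_liminf (Eventually.of_forall hle)
      _ = 0 := hto.liminf_eq
  exact (eLpNorm_eq_zero_iff (Lp.aestronglyMeasurable f) (by norm_num)).1 (le_antisymm h6 bot_le)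

end Approximation

/-! ### The inequality on H² -/

theorem lemma2p2 (a b s : ℝ) (hs : 1 / 2 - 1 / b = s)
    (ha : 3 * (1 / a - 1 / 2) = 2 / s - 4) (hb : 2 < b) (ha₁ : 1 ≤ a) (ha₂ : a < 2) :
    ∃ C : ℝ≥0, 0 < C ∧ ∀ f : Lp ℂ 2 (volume : Measure R3), MemH2 f →
      eLpNorm f (ENNReal.ofReal b) volume ≤
        C * eLpNorm (partialDeriv 2 f) (ENNReal.ofReal a) volume ^ s *
          eLpNorm (hessian f) 2 volume ^ (1 - s) := by
  have ha0 : 0 < a := by linarith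
  have hb0 : 0 < b := by linarith
  have hs0 : 0 < s := by
    have : 1 / b < 1 / 2 := one_div_lt_one_div_of_lt two_pos hb
    linarith
  have hs1 : 0 < 1 - s := by
    have : 0 < 1 / b := by positivity
    linarith
  obtain ⟨t, ht⟩ : ∃ t, t = 1 / a - 1 / 2 := ⟨_, rfl⟩
  have ht0 : 0 < t := by
    have : 1 / 2 < 1 / a := one_div_lt_one_div_of_lt ha0 ha₂
    linarith
  have ht1 : t ≤ 1 / 2 := by
    have : 1 / a ≤ 1 := by rw [div_le_one ha0]; exact ha₁
    linarith
  have hst : s * (4 + 3 * t) = 2 := by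
    rw [← ht] at ha
    have : 4 + 3 * t = 2 / s := by linarith
    rw [this]; field_simp
  -- With `β = 2/t`, eliminating `s` between `b - 2 = 2bs` and `s (4 + 3t) = 2` gives the relation
  -- required of `k = b/2`.
  have hk : b / 2 = 1 + 2 * (2 / t) / 3 := by
    have h1 : b * (3 * t) = 2 * (4 + 3 * t) := by
      have h2 : b - 2 = 2 * b * s := by rw [← hs]; field_simp
      linear_combination (4 + 3 * t) * h2 + 2 * b * hst
    field_simp
    linarith
  obtain ⟨C, hC⟩ := exists_eLpNorm_le_rpow_mul_rpow_of_contDiff (a := a) (β := 2 / t)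
    (k := b / 2) (s := s) (by rw [le_div_iff₀ ht0]; linarith) ha0
    (by rw [div_div_eq_mul_div, mul_div_cancel_left₀ _ two_ne_zero]; linarith) hk
    (by rw [← hs]; field_simp)
  rw [mul_div_cancel₀ b two_ne_zero] at hC
  -- The 9 counts the second derivatives, each bounded by the full Hessian; the 1 only ensures
  -- positivity.
  refine ⟨C * 9 ^ (1 - s) + 1, by positivity, fun f hf => ?_⟩
  set A := eLpNorm (partialDeriv 2 f) (ENNReal.ofReal a) volume with hA
  set H := eLpNorm (hessian f) 2 volume with hH
  -- `H = 0` must come first: the right side is then 0 even if `A = ⊤`. Once `H ≠ 0`, `A = ⊤` makes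
  -- the right side infinite, and in the remaining case all limits are finite, so products converge.
  rcases eq_or_ne H 0 with hH0 | hH0
  · rw [eLpNorm_congr_ae (hf.ae_eq_zero_of_hessian hH0), eLpNorm_zero]
    exact bot_le
  have hHt : H ≠ ⊤ := eLpNorm_hessian_ne_top f
  rcases eq_or_ne A ⊤ with hAt | hAt
  · have h1 : H ^ (1 - s) ≠ 0 := (ENNReal.rpow_pos (pos_iff_ne_zero.2 hH0) hHt).ne'
    have h2 : ((C * 9 ^ (1 - s) + 1 : ℝ≥0) : ℝ≥0∞) ≠ 0 := by
      rw [ENNReal.coe_ne_zero]; positivity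
    rw [hAt, ENNReal.top_rpow_of_pos hs0, ENNReal.mul_top h2, ENNReal.top_mul h1]
    exact le_top
  obtain ⟨u, E, hE, hu, huc, hlim, -, huA, huH⟩ := hf.exists_approximation ha₁ ha₂
  have hle : ∀ n, eLpNorm (u n) (ENNReal.ofReal b) volume ≤
      C * 9 ^ (1 - s) * ((A + E n) ^ s * (H + E n) ^ (1 - s)) := by
    intro n
    have h1 : hessianNorm (u n) ≤ 9 * (H + E n) :=
      hessianNorm_le_of_forall_le fun i j => (huH n i j).trans
        (add_le_add_left (eLpNorm_partialDeriv₂_le_hessian f i j) _)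
    calc eLpNorm (u n) (ENNReal.ofReal b) volume
        ≤ C * (A + E n) ^ s * (9 * (H + E n)) ^ (1 - s) := by
          refine (hC (u n) (hu n) (huc n)).trans ?_
          gcongr
          exact huA n
      _ = _ := by rw [ENNReal.mul_rpow_of_nonneg _ _ hs1.le]; ring
  have hK : (C * 9 ^ (1 - s) : ℝ≥0∞) ≠ ⊤ :=
    ENNReal.mul_ne_top ENNReal.coe_ne_top (ENNReal.rpow_ne_top_of_nonneg hs1.le (by norm_num))
  have hto : Tendsto (fun n => C * 9 ^ (1 - s) * ((A + E n) ^ s * (H + E n) ^ (1 - s))) atTop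
      (𝓝 (C * 9 ^ (1 - s) * (A ^ s * H ^ (1 - s)))) :=
    ENNReal.Tendsto.const_mul (ENNReal.Tendsto.mul (tendsto_add_rpow hE A s)
      (Or.inr (ENNReal.rpow_ne_top_of_nonneg hs1.le hHt)) (tendsto_add_rpow hE H (1 - s))
      (Or.inr (ENNReal.rpow_ne_top_of_nonneg hs0.le hAt))) (Or.inr hK)
  calc eLpNorm f (ENNReal.ofReal b) volume
      ≤ liminf (fun n => eLpNorm (u n) (ENNReal.ofReal b) volume) atTop :=
        Lp.eLpNorm_lim_le_liminf_eLpNorm (fun n => (hu n).continuous.aestronglyMeasurable) _ hlim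
    _ ≤ liminf (fun n => C * 9 ^ (1 - s) * ((A + E n) ^ s * (H + E n) ^ (1 - s))) atTop :=
        liminf_le_liminf (Eventually.of_forall hle)
    _ = C * 9 ^ (1 - s) * (A ^ s * H ^ (1 - s)) := hto.liminf_eq
    _ ≤ _ := by
        rw [← mul_assoc]
        gcongr
        rw [ENNReal.coe_add, ENNReal.coe_mul, ENNReal.coe_rpow_of_nonneg _ hs1.le]
        exact le_self_add
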